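/- Write $\mathbb N=\{0,1,2,\dots\}$. For subsets $A,B,C$ of $\mathbb N^n$ write $C=A\oplus B$ if every $a+b$ ($a\in A$, $b\in B$) lies in $C$ and every $c\in C$ has a unique representation $c=a+b$ with $a\in A,\ b\in B$; if moreover $A,B\subset C$, then $(A,B)$ is called a $C$-pair. An $\mathbb N^*$-pair is an $\mathbb N^n$-pair for some $n\ge 1$. For $A\subset\mathbb N^n$ put $A(x)=\sum_{\mathbf a\in A}x^{\mathbf a}$, where $x=(x_1,\dots,x_n)$ and $x^{\mathbf a}=x_1^{a_1}\cdots x_n^{a_n}$. Throughout, the order in which the variables (coordinates) are listed is immaterial. An $\mathbb N^n$-pair $(T,S)$ is primitive if it is not a Cartesian product of two $\mathbb N^*$-pairs of lower dimensions, i.e. if there are no partition of the $n$ coordinates into two nonempty sets of sizes $p$ and $q$, no $\mathbb N^p$-pair $(I_1,J_1)$ and no $\mathbb N^q$-pair $(I_2,J_2)$ in the respective coordinates such that $T=I_1\times I_2$ and $S=J_1\times J_2$. Let $(T,S)$ be an $\mathbb N^n$-pair and let $j\in\{1,\dots,n\}$. Write $x=(\bar x,x_j,\bar{\bar x})$, where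 $\bar x=(x_1,\dots,x_{j-1})$ and $\bar{\bar x}=(x_{j+1},\dots,x_n)$. (1) A first type extension of $(T,S)$ is a pair $(T^*,S^*)$ given by $$T^*(x)=C(x_j)\,T(\bar x,x_j^N,\bar{\bar x}),\qquad S^*(x)=D(x_j)\,S(\bar x,x_j^N,\bar{\bar x}),$$ where $N\ge 2$ and $(C,D)$ is a $\{0,1,\dots,N-1\}$-pair. (2) A second type extension of $(T,S)$ is a pair $(T^*,S^*)$ of subsets of $\mathbb N^{n+m-1}$ given, after a suitable numbering of the $n+m-1$ variables $\bar x,y,\bar{\bar x}$, by $$T^*(\bar x,y,\bar{\bar x})=L_{\mathbf a}(y)^{\delta}\,T(\bar x,y^{\mathbf a},\bar{\bar x}),\qquad S^*(\bar x,y,\bar{\bar x})=L_{\mathbf a}(y)^{1-\delta}\,S(\bar x,y^{\mathbf a},\bar{\bar x}),$$ where $\delta\in\{0,1\}$, $m\ge 2$, $\mathbf a\in(\mathbb N\setminus\{0\})^m$, $y=(y_1,\dots,y_m)$ and $L_{\mathbf a}=\mathbb N^m\setminus(\mathbb N^m+\mathbf a)$. It is called illegal if $(T,S)=(\{0\},\mathbb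 N)$ and $\delta=0$, or $(T,S)=(\mathbb N,\{0\})$ and $\delta=1$. **Theorem.** An $\mathbb N^*$-pair $(T,S)$ is primitive if and only if there are an $\mathbb N$-pair $(T_0,S_0)$ and a finite (possibly empty) sequence of first and second type extensions, none of them illegal, that leads from $(T_0,S_0)$ to $(T,S)$. -/

import Mathlib

/-- `C = A ⊕ B`: every sum `a + b` lies in `C`, and every element of `C` is such a sum in exactly
one way. For subsets of `ℕⁿ` this says precisely that the generating series satisfy
`A(x) B(x) = C(x)`, where `A(x) = ∑ a ∈ A, x ^ a`. -/
def IsDirectSum {M : Type*} [AddCommMonoid M] (A B C : Set M) : Prop :=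
  Set.BijOn (fun p : M × M => p.1 + p.2) (A ×ˢ B) C

/-- `(A, B)` is a complementing pair of `C` (a `C`-pair). -/
def IsComplementingPair {M : Type*} [AddCommMonoid M] (A B C : Set M) : Prop :=
  IsDirectSum A B C ∧ A ⊆ C ∧ B ⊆ C

/-- A pair `(T, S)` of subsets of `ℕ ^ dim`. The coordinates (variables) are indexed by
`Fin dim`. -/
structure SetPair where
  dim : ℕ
  T : Set (Fin dim → ℕ)
  S : Set (Fin dim → ℕ)

/-- An `ℕ*`-pair: a complementing pair of `ℕⁿ` for some `n ≥ 1`. -/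
def SetPair.IsNStarPair (P : SetPair) : Prop :=
  1 ≤ P.dim ∧ IsComplementingPair P.T P.S Set.univ

/-- `P` is the Cartesian product of `P₁` and `P₂`. The bijection `e` tells which coordinates of `P`
belong to `P₁` and which to `P₂`; the order of the coordinates is immaterial. -/
def SetPair.IsCartesianProduct (P₁ P₂ P : SetPair) : Prop :=
  ∃ e : Fin P₁.dim ⊕ Fin P₂.dim ≃ Fin P.dim,
    P.T = {x | (fun i => x (e (Sum.inl i))) ∈ P₁.T ∧ (fun i => x (e (Sum.inr i))) ∈ P₂.T} ∧
    P.S = {x | (fun i => x (e (Sum.inl i))) ∈ P₁.S ∧ (fun i => x (e (Sum.inr i))) ∈ P₂.S}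

/-- A primitive `ℕ*`-pair: not a Cartesian product of two `ℕ*`-pairs of lower dimensions. -/
def SetPair.IsPrimitive (P : SetPair) : Prop :=
  P.IsNStarPair ∧
    ¬ ∃ P₁ P₂ : SetPair, P₁.IsNStarPair ∧ P₂.IsNStarPair ∧ P₁.dim < P.dim ∧ P₂.dim < P.dim ∧
      SetPair.IsCartesianProduct P₁ P₂ P

/-- The set whose generating series is `C(x_j)`, for `C ⊆ ℕ`. -/
def axisSet {n : ℕ} (j : Fin n) (C : Set ℕ) : Set (Fin n → ℕ) :=
  (fun c => Pi.single j c) '' C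

/-- The set whose generating series is obtained from `T(x)` by substituting `x_j ↦ x_j ^ N`. -/
def stretchSet {n : ℕ} (j : Fin n) (N : ℕ) (T : Set (Fin n → ℕ)) : Set (Fin n → ℕ) :=
  (fun u => Function.update u j (N * u j)) '' T

/-- First type extension:
`T*(x) = C(x_j) T(…, x_j ^ N, …)` and `S*(x) = D(x_j) S(…, x_j ^ N, …)`
for a `{0, …, N - 1}`-pair `(C, D)` with `N ≥ 2`. -/
inductive FirstTypeExtension : SetPair → SetPair → Prop
  | mk {n : ℕ} (T S T' S' : Set (Fin n → ℕ)) (j : Fin n) (N : ℕ) (C D : Set ℕ)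
      (hN : 2 ≤ N) (hCD : IsComplementingPair C D (Set.Iio N))
      (hT : IsDirectSum (axisSet j C) (stretchSet j N T) T')
      (hS : IsDirectSum (axisSet j D) (stretchSet j N S) S') :
      FirstTypeExtension ⟨n, T, S⟩ ⟨n, T', S'⟩

/-- `L_a = ℕᵐ \ (ℕᵐ + a)`. -/
def cornerSet {m : ℕ} (a : Fin m → ℕ) : Set (Fin m → ℕ) :=
  Set.univ \ Set.range (fun z : Fin m → ℕ => z + a)

/-- The set whose generating series is `A(x) ^ δ`, for `δ ∈ {0, 1}`. -/
def setPow {M : Type*} [Zero M] (A : Set M) (δ : Fin 2) : Set M :=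
  if δ = 0 then {0} else A

/-- The set whose generating series is `A(y)`, where `y` is the block of new variables: the
variables of the new space are the old `x_i`, `i ≠ j`, together with `y_1, …, y_m`. -/
def blockSet {n n' m : ℕ} {j : Fin n} (e : {i : Fin n // i ≠ j} ⊕ Fin m ≃ Fin n')
    (A : Set (Fin m → ℕ)) : Set (Fin n' → ℕ) :=
  (fun z k => Sum.elim (fun _ => 0) z (e.symm k)) '' A

/-- The set whose generating series is obtained from `T(x)` by substituting
`x_j ↦ y_1 ^ a_1 ⋯ y_m ^ a_m`. -/
def substSet {n n' m : ℕ} {j : Fin n} (e : {i : Fin n // i ≠ j} ⊕ Fin m ≃ Fin n')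
    (a : Fin m → ℕ) (T : Set (Fin n → ℕ)) : Set (Fin n' → ℕ) :=
  (fun u k => Sum.elim (fun i : {i : Fin n // i ≠ j} => u i) (fun r => u j * a r) (e.symm k)) '' T

/-- Second type extension with parameter `δ`:
`T* = L_a(y) ^ δ T(…, y ^ a, …)` and `S* = L_a(y) ^ (1 - δ) S(…, y ^ a, …)`,
where `a ∈ (ℕ \ {0})ᵐ` and `m ≥ 2`. The bijection `e` numbers the `n' = n + m - 1` variables of the
new pair; their order is immaterial. -/
inductive SecondTypeExtension (δ : Fin 2) : SetPair → SetPair → Prop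
  | mk {n n' m : ℕ} (T S : Set (Fin n → ℕ)) (T' S' : Set (Fin n' → ℕ)) (j : Fin n)
      (e : {i : Fin n // i ≠ j} ⊕ Fin m ≃ Fin n') (a : Fin m → ℕ)
      (hm : 2 ≤ m) (ha : ∀ r, a r ≠ 0)
      (hT : IsDirectSum (blockSet e (setPow (cornerSet a) δ)) (substSet e a T) T')
      (hS : IsDirectSum (blockSet e (setPow (cornerSet a) (1 - δ))) (substSet e a S) S') :
      SecondTypeExtension δ ⟨n, T, S⟩ ⟨n', T', S'⟩

/-- `Q` is an extension of `P`, of the first or of the second type. -/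
def IsExtension (P Q : SetPair) : Prop :=
  FirstTypeExtension P Q ∨ ∃ δ, SecondTypeExtension δ P Q

/-- An illegal extension: of the second type, from `({0}, ℕ)` with `δ = 0` or from `(ℕ, {0})` with
`δ = 1`. -/
def IsIllegalExtension (P Q : SetPair) : Prop :=
  (P = ⟨1, {0}, Set.univ⟩ ∧ SecondTypeExtension 0 P Q) ∨
    (P = ⟨1, Set.univ, {0}⟩ ∧ SecondTypeExtension 1 P Q)

/-- `Q` is obtained from `P` by a finite (possibly empty) sequence of extensions of the first and
second type, none of which is illegal. -/
def IsLegalFiniteExtension : SetPair → SetPair → Prop :=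
  Relation.ReflTransGen (fun P Q => IsExtension P Q ∧ ¬ IsIllegalExtension P Q)

/-! ### Direct sums of sets -/

/-! A pair is a product along a set `K` of coordinates exactly when membership in each of its two
sets can be tested separately on `K` and on the complement. So primitivity means that every
nontrivial `K` has an obstructing vector (`SetPair.isPrimitive_iff`). Both types of extension are
one construction: a substitution `s` that replaces one variable by a monomial in a block of
variables, together with the corner `L` of remainders. Every vector is uniquely `l + s u` with `l ∈
L`, a division with remainder, and this carries obstructions between a pair and its extension.

Extensions preserve primitivity: a splitting that keeps the block together descends to the base, so
it has to separate the block, which needs a second type extension. There one of the two sets is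
purely substituted, hence proportional to the exponents on the block, and separation forces the
corresponding set of the base to avoid `x_j`. The base then splits off `x_j`, so it is
one-dimensional and the extension is illegal.

Conversely, let `(A, B)` be primitive of dimension at least 2. Each unit vector lies in `A` or in
`B`. If neither set had a nonzero element in the face spanned by the unit vectors of the other, both
would be faces and the pair a product. So, up to exchange, `B` has such an element, and a suitably
minimal one `v` has in `A` all vectors of its face not dominating `v`
(`IsDirectSum.exists_generator`). Having `L ⊆ A` and `v ∈ B` forces `A` to be a union of translates
of `L` and `B` to consist of substituted vectors (`IsBlockAt.block_structure`). Thus the pair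
extends its preimage under `s`, which inherits the obstructions and is primitive. Second type
reductions lower the dimension; first type ones keep it but shrink the vectors obstructing the
singletons, so the descent stops. -/

theorem isDirectSum_iff {M : Type*} [AddCommMonoid M] {A B C : Set M} :
    IsDirectSum A B C ↔ (∀ a ∈ A, ∀ b ∈ B, a + b ∈ C) ∧
      (∀ a ∈ A, ∀ b ∈ B, ∀ a' ∈ A, ∀ b' ∈ B, a + b = a' + b' → a = a' ∧ b = b') ∧
      ∀ c ∈ C, ∃ a ∈ A, ∃ b ∈ B, a + b = c := by
  constructor
  · rintro ⟨h1, h2, h3⟩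
    refine ⟨fun a ha b hb => h1 (Set.mk_mem_prod ha hb), fun a ha b hb a' ha' b' hb' h => ?_,
      fun c hc => ?_⟩
    · have := h2 (Set.mk_mem_prod ha hb) (Set.mk_mem_prod ha' hb') h
      simpa using this
    · obtain ⟨⟨a, b⟩, hab, h⟩ := h3 hc
      exact ⟨a, hab.1, b, hab.2, h⟩
  · rintro ⟨h1, h2, h3⟩
    refine ⟨fun p hp => h1 _ hp.1 _ hp.2, fun p hp p' hp' h => ?_, fun c hc => ?_⟩
    · obtain ⟨h, h'⟩ := h2 _ hp.1 _ hp.2 _ hp'.1 _ hp'.2 h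
      exact Prod.ext h h'
    · obtain ⟨a, ha, b, hb, h⟩ := h3 c hc
      exact ⟨(a, b), ⟨ha, hb⟩, h⟩

section DirectSum

variable {M : Type*} [AddCommMonoid M] {A B C : Set M}

theorem IsDirectSum.add_mem (h : IsDirectSum A B C) {a b : M} (ha : a ∈ A) (hb : b ∈ B) :
    a + b ∈ C := (isDirectSum_iff.1 h).1 a ha b hb

theorem IsDirectSum.unique (h : IsDirectSum A B C) {a b a' b' : M} (ha : a ∈ A) (hb : b ∈ B)
    (ha' : a' ∈ A) (hb' : b' ∈ B) (e : a + b = a' + b') : a = a' ∧ b = b' :=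
  (isDirectSum_iff.1 h).2.1 a ha b hb a' ha' b' hb' e

theorem IsDirectSum.exists_add_eq (h : IsDirectSum A B C) {c : M} (hc : c ∈ C) :
    ∃ a ∈ A, ∃ b ∈ B, a + b = c := (isDirectSum_iff.1 h).2.2 c hc

theorem IsDirectSum.symm (h : IsDirectSum A B C) : IsDirectSum B A C := by
  refine isDirectSum_iff.2 ⟨fun a ha b hb => add_comm b a ▸ h.add_mem hb ha,
    fun a ha b hb a' ha' b' hb' e => ?_, fun c hc => ?_⟩
  · rw [add_comm a, add_comm a'] at e
    exact (h.unique hb ha hb' ha' e).symm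
  · obtain ⟨a, ha, b, hb, e⟩ := h.exists_add_eq hc
    exact ⟨b, hb, a, ha, by rw [add_comm, e]⟩

theorem isDirectSum_singleton_zero (A : Set M) : IsDirectSum {0} A A := by
  refine isDirectSum_iff.2 ⟨by simp, ?_, fun c hc => ⟨0, rfl, c, hc, zero_add c⟩⟩
  rintro a rfl b hb a' rfl b' hb' e
  exact ⟨rfl, by simpa using e⟩

theorem IsDirectSum.eq_right (h : IsDirectSum {0} A B) : A = B := by
  ext x
  constructor
  · intro hx
    simpa using h.add_mem (Set.mem_singleton (0 : M)) hx
  · intro hx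
    obtain ⟨a, rfl, b, hb, rfl⟩ := h.exists_add_eq hx
    simpa using hb

/-- If `C = A ⊕ B`, `C' = A' ⊕ B'` and `E = C ⊕ C'`, then `E = (A ⊕ A') ⊕ (B ⊕ B')`. -/
theorem IsDirectSum.add_add_comm {A' B' C' E F G : Set M} (h : IsDirectSum A B C)
    (h' : IsDirectSum A' B' C') (hE : IsDirectSum C C' E) (hF : IsDirectSum A A' F)
    (hG : IsDirectSum B B' G) : IsDirectSum F G E := by
  refine isDirectSum_iff.2 ⟨fun f hf g hg => ?_, fun f₁ hf₁ g₁ hg₁ f₂ hf₂ g₂ hg₂ e => ?_,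
    fun x hx => ?_⟩
  · obtain ⟨a, ha, a', ha', rfl⟩ := hF.exists_add_eq hf
    obtain ⟨b, hb, b', hb', rfl⟩ := hG.exists_add_eq hg
    rw [_root_.add_add_add_comm]
    exact hE.add_mem (h.add_mem ha hb) (h'.add_mem ha' hb')
  · obtain ⟨a, ha, a', ha', rfl⟩ := hF.exists_add_eq hf₁
    obtain ⟨b, hb, b', hb', rfl⟩ := hG.exists_add_eq hg₁
    obtain ⟨c, hc, c', hc', rfl⟩ := hF.exists_add_eq hf₂
    obtain ⟨d, hd, d', hd', rfl⟩ := hG.exists_add_eq hg₂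
    rw [_root_.add_add_add_comm, _root_.add_add_add_comm c] at e
    obtain ⟨e₁, e₂⟩ := hE.unique (h.add_mem ha hb) (h'.add_mem ha' hb') (h.add_mem hc hd)
      (h'.add_mem hc' hd') e
    obtain ⟨rfl, rfl⟩ := h.unique ha hb hc hd e₁
    obtain ⟨rfl, rfl⟩ := h'.unique ha' hb' hc' hd' e₂
    exact ⟨rfl, rfl⟩
  · obtain ⟨c, hc, c', hc', rfl⟩ := hE.exists_add_eq hx
    obtain ⟨a, ha, b, hb, rfl⟩ := h.exists_add_eq hc
    obtain ⟨a', ha', b', hb', rfl⟩ := h'.exists_add_eq hc'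
    exact ⟨a + a', hF.add_mem ha ha', b + b', hG.add_mem hb hb', _root_.add_add_add_comm _ _ _ _⟩

theorem isComplementingPair_univ_iff :
    IsComplementingPair A B Set.univ ↔ IsDirectSum A B Set.univ := by
  simp [IsComplementingPair]

theorem IsDirectSum.image {M' : Type*} [AddCommMonoid M'] (h : IsDirectSum A B C) (f : M →+ M')
    (hf : Function.Injective f) : IsDirectSum (f '' A) (f '' B) (f '' C) := by
  refine isDirectSum_iff.2 ⟨?_, ?_, ?_⟩
  · rintro _ ⟨a, ha, rfl⟩ _ ⟨b, hb, rfl⟩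
    exact ⟨a + b, h.add_mem ha hb, map_add f a b⟩
  · rintro _ ⟨a, ha, rfl⟩ _ ⟨b, hb, rfl⟩ _ ⟨a', ha', rfl⟩ _ ⟨b', hb', rfl⟩ e
    rw [← map_add, ← map_add] at e
    obtain ⟨rfl, rfl⟩ := h.unique ha hb ha' hb' (hf e)
    exact ⟨rfl, rfl⟩
  · rintro _ ⟨c, hc, rfl⟩
    obtain ⟨a, ha, b, hb, rfl⟩ := h.exists_add_eq hc
    exact ⟨_, ⟨a, ha, rfl⟩, _, ⟨b, hb, rfl⟩, (map_add f a b).symm⟩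

end DirectSum

/-! ### Direct sums of sets of exponent vectors -/

section Pi

variable {ι : Type*} {A B C : Set (ι → ℕ)}

theorem pi_add_eq_zero {x y : ι → ℕ} (h : x + y = 0) : x = 0 ∧ y = 0 := by
  constructor <;> ext i <;> have := congrFun h i <;> simp at this <;> simp [this]

theorem IsDirectSum.zero_mem (h : IsDirectSum A B C) (hC : (0 : ι → ℕ) ∈ C) :
    (0 : ι → ℕ) ∈ A ∧ (0 : ι → ℕ) ∈ B := by
  obtain ⟨a, ha, b, hb, e⟩ := h.exists_add_eq hC
  obtain ⟨rfl, rfl⟩ := pi_add_eq_zero e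
  exact ⟨ha, hb⟩

theorem IsDirectSum.zero_mem_left (h : IsDirectSum A B Set.univ) : (0 : ι → ℕ) ∈ A :=
  (h.zero_mem (Set.mem_univ _)).1

theorem IsDirectSum.zero_mem_right (h : IsDirectSum A B Set.univ) : (0 : ι → ℕ) ∈ B :=
  (h.zero_mem (Set.mem_univ _)).2

theorem IsDirectSum.eq_zero_of_mem (h : IsDirectSum A B Set.univ) {x : ι → ℕ} (ha : x ∈ A)
    (hb : x ∈ B) : x = 0 :=
  (h.unique ha h.zero_mem_right h.zero_mem_left hb (by simp)).1

/-- If `a + b ∈ A` with `a ∈ A` and `b ∈ B`, then `b = 0`. -/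
theorem IsDirectSum.right_eq_zero (h : IsDirectSum A B Set.univ) {a b : ι → ℕ} (ha : a ∈ A)
    (hb : b ∈ B) (hab : a + b ∈ A) : b = 0 :=
  (h.unique ha hb hab h.zero_mem_right (by simp)).2

/-- If `a + b ∈ B` with `a ∈ A` and `b ∈ B`, then `a = 0`. -/
theorem IsDirectSum.left_eq_zero (h : IsDirectSum A B Set.univ) {a b : ι → ℕ} (ha : a ∈ A)
    (hb : b ∈ B) (hab : a + b ∈ B) : a = 0 :=
  (h.unique ha hb h.zero_mem_left hab (by simp)).1

end Pi

/-! ### Block substitutions -/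

section Block

variable {ι κ : Type*}

/-- The substitution `x_c ↦ ∏ i with q i = c, y_i ^ a i` on exponent vectors. -/
def blockSubst (q : ι → κ) (a : ι → ℕ) : (κ → ℕ) →+ (ι → ℕ) where
  toFun u i := a i * u (q i)
  map_zero' := by ext; simp
  map_add' u v := by ext; simp [mul_add]

@[simp] theorem blockSubst_apply (q : ι → κ) (a : ι → ℕ) (u : κ → ℕ) (i : ι) :
    blockSubst q a u i = a i * u (q i) := rfl

/-- The exponent vectors which, on every fibre of `q`, do not dominate `a`. -/
def blockCorner (q : ι → κ) (a : ι → ℕ) : Set (ι → ℕ) :=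
  {l | ∀ c, ∃ i, q i = c ∧ l i < a i}

variable {q : ι → κ} {a : ι → ℕ}

theorem blockSubst_injective (hq : Function.Surjective q) (ha : ∀ i, a i ≠ 0) :
    Function.Injective (blockSubst q a) := by
  intro u v h
  ext c
  obtain ⟨i, rfl⟩ := hq c
  have := congrFun h i
  simpa [ha i] using this

theorem blockCorner_of_le {l l' : ι → ℕ} (hl : l ∈ blockCorner q a) (h : l' ≤ l) :
    l' ∈ blockCorner q a := fun c => by
  obtain ⟨i, hi, hlt⟩ := hl c
  exact ⟨i, hi, (h i).trans_lt hlt⟩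

theorem zero_mem_blockCorner (hq : Function.Surjective q) (ha : ∀ i, a i ≠ 0) :
    0 ∈ blockCorner q a := fun c => by
  obtain ⟨i, hi⟩ := hq c
  exact ⟨i, hi, Nat.pos_of_ne_zero (ha i)⟩

/-- At a coordinate `i` over `c` where `l'` falls short of `a`, the hypothesis gives `a i * u c < a
i * (v c + 1)`. -/
theorem le_of_add_blockSubst_le {l l' : ι → ℕ} {u v : κ → ℕ}
    (hl' : l' ∈ blockCorner q a) (h : l + blockSubst q a u ≤ l' + blockSubst q a v) : u ≤ v := by
  intro c
  obtain ⟨i, rfl, hi⟩ := hl' c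
  have := h i
  simp only [Pi.add_apply, blockSubst_apply] at this
  by_contra! hlt
  nlinarith [Nat.mul_le_mul_left (a i) (Nat.succ_le_of_lt hlt)]

/-- Division with remainder on each fibre: `u c` is the largest number of copies of `a` that fit
under `x` over `c`. -/
theorem exists_blockCorner_add (hq : Function.Surjective q) (ha : ∀ i, a i ≠ 0) (x : ι → ℕ) :
    ∃ l ∈ blockCorner q a, ∃ u, l + blockSubst q a u = x := by
  classical
  have key : ∀ c, ∃ k, (∀ i, q i = c → a i * k ≤ x i) ∧ ∃ i, q i = c ∧ x i < a i * (k + 1) := by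
    intro c
    have hex : ∃ k, ∃ i, q i = c ∧ x i < a i * (k + 1) := by
      obtain ⟨i, hi⟩ := hq c
      refine ⟨x i, i, hi, ?_⟩
      have := Nat.pos_of_ne_zero (ha i)
      nlinarith
    refine ⟨Nat.find hex, fun i hi => ?_, Nat.find_spec hex⟩
    rcases Nat.eq_zero_or_pos (Nat.find hex) with h0 | h0
    · simp [h0]
    · have := Nat.find_min hex (Nat.sub_lt h0 one_pos)
      push Not at this
      have := this i hi
      rwa [show Nat.find hex - 1 + 1 = Nat.find hex by omega] at this
  choose u hu hu' using key
  refine ⟨fun i => x i - a i * u (q i), fun c => ?_, u, ?_⟩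
  · obtain ⟨i, rfl, hi⟩ := hu' c
    refine ⟨i, rfl, ?_⟩
    have := hu _ i rfl
    rw [mul_add] at hi
    simp only
    omega
  · ext i
    have := hu _ i rfl
    simp only [Pi.add_apply, blockSubst_apply]
    omega

theorem blockCorner_isDirectSum (hq : Function.Surjective q) (ha : ∀ i, a i ≠ 0) :
    IsDirectSum (blockCorner q a) (Set.range (blockSubst q a)) Set.univ := by
  refine isDirectSum_iff.2 ⟨by simp, ?_, fun x _ => ?_⟩
  · rintro l hl _ ⟨u, rfl⟩ l' hl' _ ⟨v, rfl⟩ e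
    have : u = v := le_antisymm (le_of_add_blockSubst_le hl' e.le)
      (le_of_add_blockSubst_le hl e.ge)
    subst this
    exact ⟨add_right_cancel e, rfl⟩
  · obtain ⟨l, hl, u, e⟩ := exists_blockCorner_add hq ha x
    exact ⟨l, hl, _, ⟨u, rfl⟩, e⟩

theorem blockCorner_add_unique (hq : Function.Surjective q) (ha : ∀ i, a i ≠ 0)
    {l l' : ι → ℕ} {u v : κ → ℕ} (hl : l ∈ blockCorner q a) (hl' : l' ∈ blockCorner q a)
    (e : l + blockSubst q a u = l' + blockSubst q a v) : l = l' ∧ u = v := by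
  obtain ⟨h₁, h₂⟩ := (blockCorner_isDirectSum hq ha).unique hl ⟨u, rfl⟩ hl' ⟨v, rfl⟩ e
  exact ⟨h₁, blockSubst_injective hq ha h₂⟩

/-- All blocks of `q` except the one over `j` are trivial. -/
structure IsBlockAt (q : ι → κ) (a : ι → ℕ) (j : κ) : Prop where
  surj : Function.Surjective q
  ne_zero : ∀ i, a i ≠ 0
  eq_one : ∀ i, q i ≠ j → a i = 1
  inj : ∀ i i', q i ≠ j → q i' = q i → i' = i

theorem IsBlockAt.corner_eq_zero {j : κ} (h : IsBlockAt q a j) {l : ι → ℕ}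
    (hl : l ∈ blockCorner q a) {i : ι} (hi : q i ≠ j) : l i = 0 := by
  obtain ⟨i', hi', hlt⟩ := hl (q i)
  obtain rfl := h.inj i i' hi hi'
  have := h.eq_one _ hi
  omega

theorem IsBlockAt.mem_corner {j : κ} (h : IsBlockAt q a j) {l : ι → ℕ}
    (h0 : ∀ i, q i ≠ j → l i = 0) (hj : ∃ i, q i = j ∧ l i < a i) : l ∈ blockCorner q a := by
  intro c
  by_cases hc : c = j
  · subst hc; exact hj
  · obtain ⟨i, rfl⟩ := h.surj c
    exact ⟨i, rfl, by rw [h0 i hc]; exact Nat.pos_of_ne_zero (h.ne_zero i)⟩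

/-- If the corner lies in `A` and its generator lies in `B`, then `A` is a union of translated
corners and `B` consists of substituted vectors. -/
theorem IsBlockAt.block_structure [Finite ι] [Finite κ] [DecidableEq κ] {j : κ}
    (h : IsBlockAt q a j)
    {A B : Set (ι → ℕ)} (hAB : IsDirectSum A B Set.univ) (hA : blockCorner q a ⊆ A)
    (hB : blockSubst q a (Pi.single j 1) ∈ B) (u : κ → ℕ) :
    (∀ l ∈ blockCorner q a, l + blockSubst q a u ∈ B → l = 0) ∧
      ((∀ l ∈ blockCorner q a, l + blockSubst q a u ∈ A) ∨
        ∀ l ∈ blockCorner q a, l + blockSubst q a u ∉ A) := by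
  classical
  set s := blockSubst q a with hs
  set L := blockCorner q a with hL
  have h0L : (0 : ι → ℕ) ∈ L := zero_mem_blockCorner h.surj h.ne_zero
  have hdec : ∀ x, ∃ l ∈ L, ∃ u, l + s u = x := exists_blockCorner_add h.surj h.ne_zero
  have huniq : ∀ {l l' : ι → ℕ} {u v : κ → ℕ}, l ∈ L → l' ∈ L → l + s u = l' + s v →
      l = l' ∧ u = v := blockCorner_add_unique h.surj h.ne_zero
  induction u using WellFoundedLT.induction with
  | ind u IH =>
  by_cases hu : u = 0
  · subst hu
    simp only [map_zero, add_zero]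
    exact ⟨fun l hl hlB => hAB.eq_zero_of_mem (hA hl) hlB, Or.inl hA⟩
  have hsu : s u ≠ 0 := fun e => hu (blockSubst_injective h.surj h.ne_zero (by simpa using e))
  -- a nontrivial decomposition of a vector of the block with both terms in lower blocks
  have low : ∀ i ∈ L, ∀ x ∈ A, ∀ y ∈ B, x + y = i + s u → (∀ l ∈ L, x ≠ l + s u) →
      (∀ l ∈ L, y ≠ l + s u) → ∃ v w, v + w = u ∧ y = s w ∧ ∀ l ∈ L, l + s v ∈ A := by
    intro i hi x hx y hy e hxu hyu
    obtain ⟨l₁, hl₁, v, rfl⟩ := hdec x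
    obtain ⟨l₂, hl₂, w, rfl⟩ := hdec y
    have hv : v ≤ u := le_of_add_blockSubst_le (l := l₁) hi (by
      rw [← hs, ← e]; exact le_self_add)
    have hw : w ≤ u := le_of_add_blockSubst_le (l := l₂) hi (by
      rw [← hs, ← e]; exact le_add_self)
    have hv' : v < u := lt_of_le_of_ne hv (by rintro rfl; exact hxu l₁ hl₁ rfl)
    have hw' : w < u := lt_of_le_of_ne hw (by rintro rfl; exact hyu l₂ hl₂ rfl)
    obtain rfl := (IH w hw').1 l₂ hl₂ hy
    have hAv := (IH v hv').2.resolve_right (fun hn => hn l₁ hl₁ hx)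
    refine ⟨v, w, ?_, by simp, hAv⟩
    have : l₁ + s (v + w) = i + s u := by rw [← e, map_add, zero_add, add_assoc]
    exact (huniq hl₁ hi this).2
  obtain ⟨x, hx, y, hy, e⟩ := hAB.exists_add_eq (Set.mem_univ (s u))
  by_cases hx0 : x = 0
  · subst hx0
    rw [zero_add] at e
    subst e
    -- Here `s u ∈ B`, so `l + s u` is itself the decomposition of that vector.
    refine ⟨fun l hl hlB => hAB.left_eq_zero (hA hl) hy hlB, Or.inr fun l hl hlA => ?_⟩
    exact hsu (hAB.right_eq_zero (hA hl) hy hlA)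
  by_cases hy0 : y = 0
  · subst hy0
    rw [add_zero] at e
    subst e
    -- Here `s u ∈ A`, and a second induction, over the corner, puts the whole block in `A`.
    have main : ∀ i, i ∈ L → i + s u ∈ A ∧ i + s u ∉ B := by
      intro i
      induction i using WellFoundedLT.induction with
      | ind i IHi =>
      intro hi
      by_cases hi0 : i = 0
      · subst hi0
        rw [zero_add]
        exact ⟨hx, fun hb => hsu (hAB.eq_zero_of_mem hx hb)⟩
      set g := s (Pi.single j 1) with hg
      have hgj : ∀ k, q k = j → g k = a k := fun k hk => by simp [hg, hs, hk]
      have hgn : ∀ k, q k ≠ j → g k = 0 := fun k hk => by simp [hg, hs, hk]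
      obtain ⟨k₀, hk₀, hk₀lt⟩ := hi j
      have hm1 : i ⊔ g - g ∈ L := by
        refine h.mem_corner (fun k hk => ?_) ⟨k₀, hk₀, ?_⟩
        · simp [hgn k hk, h.corner_eq_zero hi hk]
        · have := h.ne_zero k₀
          simp only [Pi.sub_apply, Pi.sup_apply, hgj k₀ hk₀]
          omega
      have hm1lt : i ⊔ g - g < i := by
        refine lt_of_le_of_ne (fun k => ?_) (fun hne => hi0 ?_)
        · simp only [Pi.sub_apply, Pi.sup_apply]; omega
        · ext k
          have := congrFun hne k
          simp only [Pi.sub_apply, Pi.sup_apply] at this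
          by_cases hk : q k = j
          · have h1 := hgj k hk
            have := h.ne_zero k
            simp only [Pi.zero_apply]
            omega
          · exact h.corner_eq_zero hi hk
      have hm2 : i ⊔ g - i ∈ L := by
        refine h.mem_corner (fun k hk => ?_) ?_
        · simp [hgn k hk, h.corner_eq_zero hi hk]
        · by_contra! hcon
          apply hi0
          ext k
          by_cases hk : q k = j
          · have h1 := hcon k hk
            have := h.ne_zero k
            simp only [Pi.sub_apply, Pi.sup_apply, hgj k hk] at h1
            simp only [Pi.zero_apply]
            omega
          · exact h.corner_eq_zero hi hk
      -- Otherwise `(i ⊔ g) + s u` has two decompositions, with `B`-parts `g` and `i + s u`.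
      -- Equating their `A`-parts puts one vector in the block of `u` and in the block of `0`.
      have hnB : i + s u ∉ B := by
        intro hb
        have hlow := (IHi _ hm1lt hm1).1
        have e1 : (i ⊔ g - g + s u) + g = (i ⊔ g - i) + (i + s u) := by
          ext k
          simp only [Pi.add_apply, Pi.sub_apply, Pi.sup_apply]
          omega
        have e2 := (hAB.unique hlow hB (hA hm2) hb e1).1
        exact hu (huniq hm1 hm2 (v := 0) (by simpa using e2)).2
      refine ⟨?_, hnB⟩
      obtain ⟨x', hx', y', hy', e'⟩ := hAB.exists_add_eq (Set.mem_univ (i + s u))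
      by_cases hy'0 : y' = 0
      · subst hy'0
        rw [← e', add_zero]; exact hx'
      exfalso
      -- Neither summand lies in the block of `u`: if `x'` did, `y'` would lie below `i`, hence in
      -- `A ∩ B`; if `y'` did, its corner part would be at most `i`, already excluded. Then `s v + s
      -- w = s u` contradicts `s u ∈ A`.
      obtain ⟨v, w, hvw, rfl, hvA⟩ := low i hi x' hx' y' hy' e' (by
        rintro l hl rfl
        have : l + y' = i := by
          have : (l + y') + s u = i + s u := by rw [← e']; abel
          exact add_right_cancel this
        exact hy'0 (hAB.eq_zero_of_mem
          (hA (blockCorner_of_le hi (this ▸ le_add_self))) hy')) (by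
        rintro l hl rfl
        have hli : x' + l = i := by
          have : (x' + l) + s u = i + s u := by rw [← e']; abel
          exact add_right_cancel this
        have hle : l ≤ i := hli ▸ le_add_self
        rcases hle.eq_or_lt with rfl | hlt
        · exact hnB hy'
        · exact (IHi l hlt hl).2 hy')
      have h1 := hvA 0 h0L
      rw [zero_add] at h1
      exact hy'0 (hAB.right_eq_zero h1 hy' (by rw [← map_add, hvw]; exact hx))
    exact ⟨fun l hl hlB => absurd hlB (main l hl).2, Or.inl fun l hl => (main l hl).1⟩
  · obtain ⟨v, w, hvw, rfl, hvA⟩ := low 0 h0L x hx y hy (by rw [e, zero_add])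
      (by
        rintro l hl rfl
        refine hy0 (pi_add_eq_zero (x := l) ?_).2
        have : (l + y) + s u = 0 + s u := by rw [zero_add]; nth_rw 2 [← e]; abel
        exact add_right_cancel this)
      (by
        rintro l hl rfl
        refine hx0 (pi_add_eq_zero (y := l) ?_).1
        have : (x + l) + s u = 0 + s u := by rw [zero_add]; nth_rw 2 [← e]; abel
        exact add_right_cancel this)
    -- For each corner vector `l` this is the decomposition of `l + s u`, with both `B`-part and
    -- `A`-part nonzero when `l ≠ 0`.
    have key : ∀ l, l + s u = (l + s v) + s w := fun l => by rw [← hvw, map_add, add_assoc]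
    refine ⟨fun l hl hlB => ?_, Or.inr fun l hl hlA => ?_⟩
    · rw [key] at hlB
      have := hAB.left_eq_zero (hvA l hl) hy hlB
      exact (pi_add_eq_zero this).1
    · rw [key] at hlA
      exact hy0 (hAB.right_eq_zero (hvA l hl) hy hlA)

end Block

/-! ### Recovering the base of a corner extension -/

section Reduction

variable {ι κ : Type*} {q : ι → κ} {a : ι → ℕ}

/-- `(A, B)` arises from `(T, S)` by the block substitution, with the corner added to `T`. -/
structure IsCornerExtension (q : ι → κ) (a : ι → ℕ) (T S : Set (κ → ℕ)) (A B : Set (ι → ℕ)) :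
    Prop where
  surj : Function.Surjective q
  ne_zero : ∀ i, a i ≠ 0
  mem_left : ∀ l ∈ blockCorner q a, ∀ u, l + blockSubst q a u ∈ A ↔ u ∈ T
  mem_right : ∀ l ∈ blockCorner q a, ∀ u, l + blockSubst q a u ∈ B ↔ l = 0 ∧ u ∈ S

/-- The base consists of the preimages under `s`: by the block dichotomy each block can be tested at
its point `s u`. -/
theorem IsBlockAt.isCornerExtension [Finite ι] [Finite κ] [DecidableEq κ] {j : κ}
    (h : IsBlockAt q a j) {A B : Set (ι → ℕ)} (hAB : IsDirectSum A B Set.univ)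
    (hA : blockCorner q a ⊆ A) (hB : blockSubst q a (Pi.single j 1) ∈ B) :
    IsCornerExtension q a {u | blockSubst q a u ∈ A} {u | blockSubst q a u ∈ B} A B := by
  have key := h.block_structure hAB hA hB
  have h0 := zero_mem_blockCorner h.surj h.ne_zero
  refine ⟨h.surj, h.ne_zero, fun l hl u => ⟨fun hm => ?_, fun hm => ?_⟩,
    fun l hl u => ⟨fun hm => ?_, ?_⟩⟩
  · have := ((key u).2.resolve_right fun hn => hn l hl hm) 0 h0
    simpa using this
  · exact ((key u).2.resolve_right fun hn => hn 0 h0 (by simpa using hm)) l hl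
  · obtain rfl := (key u).1 l hl hm
    exact ⟨rfl, by simpa using hm⟩
  · rintro ⟨rfl, hm⟩
    simpa using hm

variable {T S : Set (κ → ℕ)} {A B : Set (ι → ℕ)}

theorem IsCornerExtension.isDirectSum_left (h : IsCornerExtension q a T S A B) :
    IsDirectSum (blockCorner q a) (blockSubst q a '' T) A := by
  refine isDirectSum_iff.2 ⟨?_, ?_, fun x hx => ?_⟩
  · rintro l hl _ ⟨u, hu, rfl⟩
    exact (h.mem_left l hl u).2 hu
  · rintro l hl _ ⟨u, hu, rfl⟩ l' hl' _ ⟨u', hu', rfl⟩ e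
    obtain ⟨rfl, rfl⟩ := blockCorner_add_unique h.surj h.ne_zero hl hl' e
    exact ⟨rfl, rfl⟩
  · obtain ⟨l, hl, u, rfl⟩ := exists_blockCorner_add h.surj h.ne_zero x
    exact ⟨l, hl, _, ⟨u, (h.mem_left l hl u).1 hx, rfl⟩, rfl⟩

theorem IsCornerExtension.isDirectSum_right (h : IsCornerExtension q a T S A B) :
    IsDirectSum {0} (blockSubst q a '' S) B := by
  have h0 := zero_mem_blockCorner h.surj h.ne_zero
  convert isDirectSum_singleton_zero B
  ext x
  constructor
  · rintro ⟨u, hu, rfl⟩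
    simpa using (h.mem_right 0 h0 u).2 ⟨rfl, hu⟩
  · intro hx
    obtain ⟨l, hl, u, rfl⟩ := exists_blockCorner_add h.surj h.ne_zero x
    obtain ⟨rfl, hu⟩ := (h.mem_right l hl u).1 hx
    exact ⟨u, hu, by simp⟩

/-- In a decomposition of `s u` the `B`-part is substituted, so by unique division the two quotients
add up to `u`; membership of the `A`-part depends on its quotient alone. -/
theorem IsCornerExtension.isDirectSum_base (h : IsCornerExtension q a T S A B)
    (hAB : IsDirectSum A B Set.univ) : IsDirectSum T S Set.univ := by
  have h0 := zero_mem_blockCorner h.surj h.ne_zero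
  have hT : ∀ u, blockSubst q a u ∈ A ↔ u ∈ T := fun u => by simpa using h.mem_left 0 h0 u
  have hS : ∀ u, blockSubst q a u ∈ B ↔ u ∈ S := fun u => by simpa using h.mem_right 0 h0 u
  have hinj := blockSubst_injective h.surj h.ne_zero
  refine isDirectSum_iff.2 ⟨by simp, fun t ht s hs t' ht' s' hs' e => ?_, fun u _ => ?_⟩
  · obtain ⟨h1, h2⟩ := hAB.unique ((hT t).2 ht) ((hS s).2 hs) ((hT t').2 ht') ((hS s').2 hs')
      (by rw [← map_add, e, map_add])
    exact ⟨hinj h1, hinj h2⟩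
  · obtain ⟨x, hx, y, hy, e⟩ := hAB.exists_add_eq (Set.mem_univ (blockSubst q a u))
    obtain ⟨l, hl, t, rfl⟩ := exists_blockCorner_add h.surj h.ne_zero x
    obtain ⟨l', hl', s, rfl⟩ := exists_blockCorner_add h.surj h.ne_zero y
    obtain ⟨rfl, hs⟩ := (h.mem_right l' hl' s).1 hy
    have e' : l + blockSubst q a (t + s) = 0 + blockSubst q a u := by
      rw [zero_add, ← e, map_add, zero_add, add_assoc]
    exact ⟨t, (h.mem_left l hl t).1 hx, s, hs, (blockCorner_add_unique h.surj h.ne_zero hl h0 e').2⟩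

end Reduction

/-! ### Splitting along a set of coordinates -/

section Splitting

variable {ι κ : Type*}

/-- Membership of `x` in `A` can be tested separately on the coordinates in `K` and on the others. -/
def SplitsAt (K : Set ι) (A : Set (ι → ℕ)) (x : ι → ℕ) : Prop :=
  x ∈ A ↔ K.indicator x ∈ A ∧ Kᶜ.indicator x ∈ A

theorem blockSubst_indicator (q : ι → κ) (a : ι → ℕ) (K : Set κ) (u : κ → ℕ) :
    blockSubst q a (K.indicator u) = (q ⁻¹' K).indicator (blockSubst q a u) := by
  classical
  ext i
  simp [Set.indicator_apply]

theorem indicator_le_pi (K : Set ι) (x : ι → ℕ) : K.indicator x ≤ x :=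
  Set.indicator_le_self K x

/-- The corner is downward closed, so restriction to a union of fibres acts separately on remainder
and quotient. Membership in `A` sees only the quotient, and the extra condition `l = 0` for `B`
splits along any set. -/
theorem IsCornerExtension.splitsAt {q : ι → κ} {a : ι → ℕ} {T S : Set (κ → ℕ)}
    {A B : Set (ι → ℕ)} (h : IsCornerExtension q a T S A B) {K : Set κ} {l : ι → ℕ}
    (hl : l ∈ blockCorner q a) {u : κ → ℕ} (hT : SplitsAt K T u) (hS : SplitsAt K S u) :
    SplitsAt (q ⁻¹' K) A (l + blockSubst q a u) ∧
      SplitsAt (q ⁻¹' K) B (l + blockSubst q a u) := by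
  have hl1 : ∀ K : Set ι, K.indicator l ∈ blockCorner q a := fun K =>
    blockCorner_of_le hl (indicator_le_pi K l)
  unfold SplitsAt at *
  rw [← Set.preimage_compl]
  simp only [Set.indicator_add', ← blockSubst_indicator]
  rw [h.mem_left _ hl, h.mem_left _ (hl1 _), h.mem_left _ (hl1 _), h.mem_right _ hl,
    h.mem_right _ (hl1 _), h.mem_right _ (hl1 _)]
  refine ⟨hT, ?_⟩
  have : l = 0 ↔ (q ⁻¹' K).indicator l = 0 ∧ (q ⁻¹' Kᶜ).indicator l = 0 := by
    constructor
    · rintro rfl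
      simp
    · rintro ⟨h1, h2⟩
      rw [← Set.indicator_self_add_compl (q ⁻¹' K) l, h1, ← Set.preimage_compl, h2, add_zero]
  rw [this, hS]
  tauto

/-- In a direct sum of a part of the corner and a substituted set, the substituted vectors are
exactly those coming from the base. -/
theorem blockSubst_mem_iff {q : ι → κ} {a : ι → ℕ} (hq : Function.Surjective q)
    (ha : ∀ i, a i ≠ 0) {C A : Set (ι → ℕ)} {T : Set (κ → ℕ)} (hC : C ⊆ blockCorner q a)
    (hC0 : 0 ∈ C) (h : IsDirectSum C (blockSubst q a '' T) A) (u : κ → ℕ) :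
    blockSubst q a u ∈ A ↔ u ∈ T := by
  constructor
  · intro hu
    obtain ⟨c, hc, _, ⟨t, ht, rfl⟩, e⟩ := h.exists_add_eq hu
    obtain ⟨-, rfl⟩ := blockCorner_add_unique hq ha (hC hc) (zero_mem_blockCorner hq ha)
      (by rw [e, zero_add])
    exact ht
  · intro hu
    simpa using h.add_mem hC0 ⟨u, hu, rfl⟩

theorem splitsAt_of_preimage {q : ι → κ} {a : ι → ℕ} {A : Set (ι → ℕ)} {T : Set (κ → ℕ)}
    (h : ∀ u, blockSubst q a u ∈ A ↔ u ∈ T) {K : Set κ} {u : κ → ℕ}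
    (hA : SplitsAt (q ⁻¹' K) A (blockSubst q a u)) : SplitsAt K T u := by
  unfold SplitsAt at *
  rwa [← Set.preimage_compl, ← blockSubst_indicator, ← blockSubst_indicator, h, h, h] at hA

/-- Induction on `w`: were the `X`-part of a vector nonzero, its `Z`-part would be smaller and could
be moved along the `j`-axis, giving an element of `Z` with nonzero `X`-part, against uniqueness. -/
theorem add_single_mem_iff [Finite κ] [DecidableEq κ] {X Z : Set (κ → ℕ)}
    (h : IsDirectSum X Z Set.univ) {j : κ} (hX : ∀ x ∈ X, x j = 0) (k : ℕ) (w : κ → ℕ)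
    (hw : w j = 0) : w + Pi.single j k ∈ Z ↔ w ∈ Z := by
  induction w using WellFoundedLT.induction with
  | ind w IH =>
  constructor
  · intro hm
    obtain ⟨x, hx, z, hz, rfl⟩ := h.exists_add_eq (Set.mem_univ w)
    by_cases hx0 : x = 0
    · simpa [hx0] using hz
    have hzj : z j = 0 := by simp at hw; exact hw.2
    have hlt : z < x + z := lt_of_le_of_ne le_add_self (fun e => hx0 (by simpa using e))
    have := (IH z hlt hzj).2 hz
    rw [add_assoc] at hm
    exact absurd (h.left_eq_zero hx this hm) hx0
  · intro hm
    obtain ⟨x, hx, z, hz, e⟩ := h.exists_add_eq (Set.mem_univ (w + Pi.single j k))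
    by_cases hx0 : x = 0
    · rw [← e, hx0, zero_add]; exact hz
    have hxj := hX x hx
    have hzj : z j = k := by
      have := congrFun e j
      simpa [hxj, hw] using this
    have hz' : z = Function.update z j 0 + Pi.single j k := by
      ext i
      by_cases hi : i = j
      · subst hi; simp [hzj]
      · simp [hi]
    have hw' : x + Function.update z j 0 = w := by
      rw [hz', ← add_assoc] at e
      exact add_right_cancel e
    have hlt : Function.update z j 0 < w := by
      rw [← hw']
      exact lt_of_le_of_ne le_add_self (fun e => hx0 (by simpa using e))
    rw [hz'] at hz
    have := (IH _ hlt (by simp)).1 hz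
    exact absurd (h.left_eq_zero hx this (by rwa [hw'])) hx0

/-- When `X` does not involve `x_j`, `Z` is a cylinder in the direction `j`. -/
theorem splitsAt_singleton [Finite κ] {X Z : Set (κ → ℕ)}
    (h : IsDirectSum X Z Set.univ) {j : κ} (hX : ∀ x ∈ X, x j = 0) (u : κ → ℕ) :
    SplitsAt {j} X u ∧ SplitsAt {j} Z u := by
  classical
  have hu : u = ({j}ᶜ : Set κ).indicator u + Pi.single j (u j) := by
    ext i
    by_cases hi : i = j
    · subst hi; simp
    · simp [hi]
  have hs : ({j} : Set κ).indicator u = Pi.single j (u j) := by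
    ext i
    by_cases hi : i = j
    · subst hi; simp
    · simp [hi]
  refine ⟨⟨fun hm => ?_, fun hm => ?_⟩, ?_⟩
  · have h0 := hX u hm
    rw [hs, h0, Pi.single_zero]
    refine ⟨h.zero_mem_left, ?_⟩
    rw [h0, Pi.single_zero, add_zero] at hu
    rwa [← hu]
  · have h0 := hX _ hm.1
    rw [hs, Pi.single_eq_same] at h0
    rw [hu, h0, Pi.single_zero, add_zero]
    exact hm.2
  · unfold SplitsAt
    have h1 := add_single_mem_iff h hX (u j) (({j}ᶜ : Set κ).indicator u) (by simp)
    have h2 := add_single_mem_iff h hX (u j) 0 rfl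
    rw [zero_add] at h2
    rw [← hu] at h1
    rw [h1, hs, h2]
    simp [h.zero_mem_right]

theorem splitsAt_of_face {A : Set (ι → ℕ)} {J : ι → Prop} (h : ∀ x, x ∈ A ↔ ∀ i, x i ≠ 0 → J i) (K : Set ι)
    (x : ι → ℕ) : SplitsAt K A x := by
  classical
  unfold SplitsAt
  rw [h, h, h]
  constructor
  · exact fun hx => ⟨fun i hi => hx i (by simp at hi; exact hi.2),
      fun i hi => hx i (by simp at hi; exact hi.2)⟩
  · rintro ⟨h1, h2⟩ i hi
    by_cases hK : i ∈ K
    · exact h1 i (by simp [hK, hi])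
    · exact h2 i (by simp [hK, hi])

end Splitting

/-! ### Existence of a reduction -/

section Generator

variable {ι : Type*} [DecidableEq ι] {A B : Set (ι → ℕ)}

theorem IsDirectSum.single_one_mem (h : IsDirectSum A B Set.univ) (i : ι) :
    Pi.single i 1 ∈ A ∨ Pi.single i 1 ∈ B := by
  obtain ⟨a, ha, b, hb, e⟩ := h.exists_add_eq (Set.mem_univ (Pi.single i 1))
  have hk : ∀ k, k ≠ i → a k = 0 ∧ b k = 0 := fun k hk => by
    have := congrFun e k
    simpa [hk] using this
  have hi : a i + b i = 1 := by simpa using congrFun e i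
  by_cases h0 : a i = 0
  · right
    have : a = 0 := by
      ext k
      by_cases hki : k = i
      · subst hki; exact h0
      · exact (hk k hki).1
    rwa [← e, this, zero_add]
  · left
    have : b = 0 := by
      ext k
      by_cases hki : k = i
      · subst hki; simp; omega
      · exact (hk k hki).2
    rwa [← e, this, add_zero]

/-- If `B` has a nonzero element supported on the coordinates whose unit vectors lie in `A`, then it
has one, say `v`, such that `A` contains all vectors of the face of `v` not dominating `v`. -/
theorem IsDirectSum.exists_generator [Finite ι] (h : IsDirectSum A B Set.univ) {b : ι → ℕ}
    (hb : b ∈ B) (hb0 : b ≠ 0) (hbA : ∀ i, b i ≠ 0 → Pi.single i 1 ∈ A) :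
    ∃ v ∈ B, v ≠ 0 ∧ (∀ i, v i ≠ 0 → Pi.single i 1 ∈ A) ∧
      ∀ l : ι → ℕ, (∀ i, v i = 0 → l i = 0) → ¬ v ≤ l → l ∈ A := by
  -- Minimize twice: first the support, then the vector among the nonzero elements of `B` supported
  -- there.
  obtain ⟨Y, ⟨⟨b', hb'B, hb'0, hb'A, rfl⟩, hYmin⟩⟩ := exists_minimal_of_wellFoundedLT
    (fun Y : Set ι => ∃ b ∈ B, b ≠ 0 ∧ (∀ i, b i ≠ 0 → Pi.single i 1 ∈ A) ∧
      Function.support b = Y) ⟨_, b, hb, hb0, hbA, rfl⟩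
  set Y := Function.support b' with hY
  obtain ⟨v, ⟨hvB, hv0, hvY⟩, hvmin⟩ := exists_minimal_of_wellFoundedLT
    (fun b : ι → ℕ => b ∈ B ∧ b ≠ 0 ∧ Function.support b ⊆ Y) ⟨b', hb'B, hb'0, subset_rfl⟩
  -- nonzero elements of `B` supported on `Y` have support equal to `Y`
  have hfull : ∀ c ∈ B, Function.support c ⊆ Y → c ≠ 0 → ∀ i ∈ Y, c i ≠ 0 := by
    intro c hc hcY hc0 i hi
    exact hYmin ⟨c, hc, hc0, fun k hk => hb'A k (hcY hk), rfl⟩ hcY hi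
  have hproper : ∀ z : ι → ℕ, Function.support z ⊆ Y → (∃ i ∈ Y, z i = 0) → z ∈ A := by
    rintro z hz ⟨i, hi, hzi⟩
    obtain ⟨x, hx, y, hy, rfl⟩ := h.exists_add_eq (Set.mem_univ z)
    by_cases hy0 : y = 0
    · simpa [hy0] using hx
    · refine absurd ?_ (hfull y hy (fun k hk => hz ?_) hy0 i hi)
      · simp at hzi; exact hzi.2
      · simp only [Function.mem_support, Pi.add_apply] at hk ⊢
        omega
  -- Otherwise `v` and `c` are incomparable, so `v ⊔ c - v` and `v ⊔ c - c` each vanish somewhere on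
  -- `Y` and lie in `A`; then `v ⊔ c` has two decompositions.
  have hchain : ∀ c ∈ B, Function.support c ⊆ Y → c ≠ 0 → v ≤ c := by
    intro c hc hcY hc0
    by_contra hvc
    have hcv : ¬ c ≤ v := fun hcv => hvc (hvmin ⟨hc, hc0, hcY⟩ hcv)
    have hvz : ∀ i, i ∉ Y → v i = 0 := fun i hi => by
      by_contra hn; exact hi (hvY hn)
    have hcz : ∀ i, i ∉ Y → c i = 0 := fun i hi => by
      by_contra hn; exact hi (hcY hn)
    have hsup : ∀ d : ι → ℕ, Function.support (v ⊔ c - d) ⊆ Y := by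
      intro d i hi
      by_contra hn
      simp [hvz i hn, hcz i hn] at hi
    simp only [Pi.le_def, not_forall, not_le] at hvc hcv
    obtain ⟨i, hi⟩ := hvc
    obtain ⟨k, hk⟩ := hcv
    have h1 : v ⊔ c - v ∈ A := hproper _ (hsup v) ⟨i, by
      by_contra hn; rw [hvz i hn] at hi; omega, by
      simp only [Pi.sub_apply, Pi.sup_apply]; omega⟩
    have h2 : v ⊔ c - c ∈ A := hproper _ (hsup c) ⟨k, by
      by_contra hn; rw [hcz k hn] at hk; omega, by
      simp only [Pi.sub_apply, Pi.sup_apply]; omega⟩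
    have h3 := (h.unique h1 hvB h2 hc (by
      ext r; simp only [Pi.sub_apply, Pi.sup_apply, Pi.add_apply]; omega)).2
    rw [h3] at hi
    exact lt_irrefl _ hi
  refine ⟨v, hvB, hv0, fun i hi => hb'A i (hvY hi), fun l hl hvl => ?_⟩
  obtain ⟨x, hx, y, hy, rfl⟩ := h.exists_add_eq (Set.mem_univ l)
  by_cases hy0 : y = 0
  · simpa [hy0] using hx
  refine absurd ((hchain y hy (fun i hi => ?_) hy0).trans le_add_self) hvl
  by_contra hn
  have := hl i (by by_contra hn'; exact hn (hvY hn'))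
  simp at this
  exact hi this.2

/-- If neither set has a nonzero element in the face spanned by the unit vectors of the other one,
then both are faces. -/
theorem IsDirectSum.mem_iff_of_faces (h : IsDirectSum A B Set.univ)
    (hB : ∀ b ∈ B, (∀ i, b i ≠ 0 → Pi.single i 1 ∈ A) → b = 0)
    (hA : ∀ a ∈ A, (∀ i, a i ≠ 0 → Pi.single i 1 ∈ B) → a = 0) (x : ι → ℕ) :
    x ∈ A ↔ ∀ i, x i ≠ 0 → Pi.single i 1 ∈ A := by
  classical
  have face : ∀ {A B : Set (ι → ℕ)}, IsDirectSum A B Set.univ →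
      (∀ b ∈ B, (∀ i, b i ≠ 0 → Pi.single i 1 ∈ A) → b = 0) → ∀ x : ι → ℕ,
      (∀ i, x i ≠ 0 → Pi.single i 1 ∈ A) → x ∈ A := by
    intro A B h hB x hx
    obtain ⟨a, ha, b, hb, rfl⟩ := h.exists_add_eq (Set.mem_univ x)
    have := hB b hb (fun i hi => hx i (by simp [hi]))
    simpa [this] using ha
  refine ⟨fun hx i hi => ?_, face h hB x⟩
  by_contra hn
  set J : Set ι := {i | Pi.single i 1 ∈ A} with hJ
  -- The parts of `x` on and off `J` lie in `A` and `B`; as `x ∈ A`, the second one vanishes.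
  have h1 : J.indicator x ∈ A := face h hB _ (fun i hi =>
    show i ∈ J from Set.mem_of_indicator_ne_zero hi)
  have h2 : Jᶜ.indicator x ∈ B := face h.symm hA _ (fun i hi =>
    (h.single_one_mem i).resolve_left (show i ∈ Jᶜ from Set.mem_of_indicator_ne_zero hi))
  have h3 := h.right_eq_zero h1 h2 (by rwa [Set.indicator_self_add_compl])
  have := congrFun h3 i
  rw [Set.indicator_of_mem (show i ∈ Jᶜ from hn)] at this
  exact hi this

end Generator

/-! ### Primitivity and splitting -/

theorem SetPair.IsNStarPair.isDirectSum {P : SetPair} (h : P.IsNStarPair) :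
    IsDirectSum P.T P.S Set.univ := isComplementingPair_univ_iff.1 h.2

theorem extend_add_zero {n k : ℕ} {g : Fin k → Fin n} (hg : Function.Injective g)
    (x y : Fin k → ℕ) :
    Function.extend g (x + y) 0 = Function.extend g x 0 + Function.extend g y 0 := by
  ext i
  by_cases hi : ∃ r, g r = i
  · obtain ⟨r, rfl⟩ := hi
    simp [hg.extend_apply]
  · simp [Function.extend_apply' _ _ _ hi]

theorem extend_comp_zero {n k : ℕ} {g : Fin k → Fin n} (hg : Function.Injective g)
    (x : Fin n → ℕ) (hx : ∀ i, (¬ ∃ r, g r = i) → x i = 0) :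
    Function.extend g (fun r => x (g r)) 0 = x := by
  ext i
  by_cases hi : ∃ r, g r = i
  · obtain ⟨r, rfl⟩ := hi
    simp [hg.extend_apply]
  · simp [Function.extend_apply' _ _ _ hi, hx i hi]

/-- A direct sum decomposition of `ℕⁿ` induces one on the coordinates in the range of `g`. -/
theorem IsDirectSum.face {n k : ℕ} {T S : Set (Fin n → ℕ)} {g : Fin k → Fin n}
    (hg : Function.Injective g) (h : IsDirectSum T S Set.univ) :
    IsDirectSum {y : Fin k → ℕ | Function.extend g y 0 ∈ T} {y | Function.extend g y 0 ∈ S}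
      Set.univ := by
  refine isDirectSum_iff.2 ⟨by simp, ?_, ?_⟩
  · intro t ht s hs t' ht' s' hs' e
    obtain ⟨h1, h2⟩ := h.unique ht hs ht' hs' (by
      rw [← extend_add_zero hg, ← extend_add_zero hg]; exact congrArg (Function.extend g · 0) e)
    have hinj : Function.Injective (fun y : Fin k → ℕ => Function.extend g y 0) := by
      intro y y' hy
      ext r
      have := congrFun hy (g r)
      simpa [hg.extend_apply] using this
    exact ⟨hinj h1, hinj h2⟩
  · intro y _
    obtain ⟨t, ht, s, hs, e⟩ := h.exists_add_eq (Set.mem_univ (Function.extend g y 0))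
    have hz : ∀ i, (¬ ∃ r, g r = i) → t i = 0 ∧ s i = 0 := fun i hi => by
      have := congrFun e i
      rw [Function.extend_apply' _ _ _ hi] at this
      simpa using this
    refine ⟨fun r => t (g r), ?_, fun r => s (g r), ?_, ?_⟩
    · change Function.extend g (fun r => t (g r)) 0 ∈ T
      rwa [extend_comp_zero hg t fun i hi => (hz i hi).1]
    · change Function.extend g (fun r => s (g r)) 0 ∈ S
      rwa [extend_comp_zero hg s fun i hi => (hz i hi).2]
    · ext r
      have := congrFun e (g r)
      simpa [hg.extend_apply] using this

/-- The pair `P` does not split along `K` at `x`. -/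
def SetPair.Obstructs (P : SetPair) (K : Set (Fin P.dim)) (x : Fin P.dim → ℕ) : Prop :=
  ¬ (SplitsAt K P.T x ∧ SplitsAt K P.S x)

/-- The factors are the faces on `K` and on its complement; extension by zero turns restriction into
`Set.indicator`. -/
theorem exists_isCartesianProduct_of_splitsAt {P : SetPair} (hP : P.IsNStarPair)
    {K : Set (Fin P.dim)} (hK : K.Nonempty) (hK' : K ≠ Set.univ)
    (h : ∀ x, SplitsAt K P.T x ∧ SplitsAt K P.S x) :
    ∃ P₁ P₂ : SetPair, P₁.IsNStarPair ∧ P₂.IsNStarPair ∧ P₁.dim < P.dim ∧ P₂.dim < P.dim ∧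
      SetPair.IsCartesianProduct P₁ P₂ P := by
  classical
  let f := (Fintype.equivFin K).symm
  let f' := (Fintype.equivFin (Kᶜ : Set _)).symm
  let e : Fin (Fintype.card K) ⊕ Fin (Fintype.card (Kᶜ : Set _)) ≃ Fin P.dim :=
    (Equiv.sumCongr f f').trans (Equiv.Set.sumCompl K)
  have he : ∀ r, e (Sum.inl r) = f r := fun r => by simp [e]
  have he' : ∀ r, e (Sum.inr r) = f' r := fun r => by simp [e]
  let g : Fin (Fintype.card K) → Fin P.dim := fun r => e (Sum.inl r)
  let g' : Fin (Fintype.card (Kᶜ : Set _)) → Fin P.dim := fun r => e (Sum.inr r)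
  have hg : Function.Injective g := e.injective.comp Sum.inl_injective
  have hg' : Function.Injective g' := e.injective.comp Sum.inr_injective
  have hK'' : (Kᶜ : Set _).Nonempty := Set.nonempty_compl.2 hK'
  have hpos : 0 < Fintype.card K := Fintype.card_pos_iff.2 hK.to_subtype
  have hpos' : 0 < Fintype.card (Kᶜ : Set _) := Fintype.card_pos_iff.2 hK''.to_subtype
  have hsum : Fintype.card K + Fintype.card (Kᶜ : Set _) = P.dim := by
    simpa using Fintype.card_congr e
  have hind : ∀ x : Fin P.dim → ℕ, Function.extend g (fun r => x (g r)) 0 = K.indicator x := by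
    intro x
    rw [← extend_comp_zero hg (K.indicator x)]
    · congr 1
      ext r
      have : g r ∈ K := by simp [g, he]
      simp [this]
    · intro i hi
      refine Set.indicator_of_notMem (fun hiK => hi ⟨f.symm ⟨i, hiK⟩, ?_⟩) _
      simp [g, he]
  have hind' : ∀ x : Fin P.dim → ℕ,
      Function.extend g' (fun r => x (g' r)) 0 = Kᶜ.indicator x := by
    intro x
    rw [← extend_comp_zero hg' (Kᶜ.indicator x)]
    · congr 1
      ext r
      have : g' r ∈ Kᶜ := by simp only [g', he']; exact (f' r).2
      rw [Set.indicator_of_mem this]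
    · intro i hi
      refine Set.indicator_of_notMem (fun hiK => hi ⟨f'.symm ⟨i, hiK⟩, ?_⟩) _
      simp [g', he']
  refine ⟨⟨_, _, _⟩, ⟨_, _, _⟩, ⟨hpos, isComplementingPair_univ_iff.2 (hP.isDirectSum.face hg)⟩,
    ⟨hpos', isComplementingPair_univ_iff.2 (hP.isDirectSum.face hg')⟩, ?_, ?_, e, ?_, ?_⟩
  · change Fintype.card K < P.dim
    omega
  · change Fintype.card (Kᶜ : Set _) < P.dim
    omega
  · ext x
    refine (h x).1.trans ?_
    rw [← hind, ← hind']
    rfl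
  · ext x
    refine (h x).2.trans ?_
    rw [← hind, ← hind']
    rfl

/-- The sets of the factors contain `0`, so zeroing the coordinates of one factor leaves only the
test in the other. -/
theorem exists_splitsAt_of_isCartesianProduct {P P₁ P₂ : SetPair} (h₁ : P₁.IsNStarPair)
    (h₂ : P₂.IsNStarPair) (h : SetPair.IsCartesianProduct P₁ P₂ P) :
    ∃ K : Set (Fin P.dim), K.Nonempty ∧ K ≠ Set.univ ∧
      ∀ x, SplitsAt K P.T x ∧ SplitsAt K P.S x := by
  classical
  obtain ⟨e, hT, hS⟩ := h
  have hl : ∀ r, e (Sum.inl r) ∈ Set.range (fun r => e (Sum.inl r)) := fun r => ⟨r, rfl⟩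
  have hr : ∀ r, e (Sum.inr r) ∉ Set.range (fun r => e (Sum.inl r)) := by
    rintro r ⟨r', h⟩
    exact Sum.inl_ne_inr (e.injective h)
  have key : ∀ (A₁ : Set (Fin P₁.dim → ℕ)) (A₂ : Set (Fin P₂.dim → ℕ)), 0 ∈ A₁ → 0 ∈ A₂ → ∀ x,
      SplitsAt (Set.range fun r => e (Sum.inl r))
        {x | (fun i => x (e (Sum.inl i))) ∈ A₁ ∧ (fun i => x (e (Sum.inr i))) ∈ A₂} x := by
    intro A₁ A₂ h1 h2 x
    unfold SplitsAt
    simp only [Set.mem_ofPred_eq, Set.indicator_of_mem (hl _), Set.indicator_of_notMem (hr _),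
      Set.indicator_of_notMem (Set.notMem_compl_iff.2 (hl _)),
      Set.indicator_of_mem (Set.mem_compl (hr _))]
    have h1' : (fun _ => 0 : Fin P₁.dim → ℕ) ∈ A₁ := h1
    have h2' : (fun _ => 0 : Fin P₂.dim → ℕ) ∈ A₂ := h2
    tauto
  refine ⟨Set.range (fun r => e (Sum.inl r)), ⟨_, hl ⟨0, h₁.1⟩⟩, fun hu => ?_, fun x => ⟨?_, ?_⟩⟩
  · exact hr ⟨0, h₂.1⟩ (hu ▸ Set.mem_univ _)
  · rw [hT]
    exact key _ _ h₁.isDirectSum.zero_mem_left h₂.isDirectSum.zero_mem_left x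
  · rw [hS]
    exact key _ _ h₁.isDirectSum.zero_mem_right h₂.isDirectSum.zero_mem_right x

/-- Replaces a quantification over factors by one vector for each `K`, which can be carried along
substitutions. -/
theorem SetPair.isPrimitive_iff {P : SetPair} :
    P.IsPrimitive ↔ P.IsNStarPair ∧
      ∀ K : Set (Fin P.dim), K.Nonempty → K ≠ Set.univ → ∃ x, P.Obstructs K x := by
  refine and_congr_right fun hP => ⟨fun h K hK hK' => ?_, fun h => ?_⟩
  · by_contra! hn
    exact h (exists_isCartesianProduct_of_splitsAt hP hK hK' fun x => not_not.1 (hn x))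
  · rintro ⟨P₁, P₂, h₁, h₂, -, -, h'⟩
    obtain ⟨K, hK, hK', hs⟩ := exists_splitsAt_of_isCartesianProduct h₁ h₂ h'
    obtain ⟨x, hx⟩ := h K hK hK'
    exact hx (hs x)

/-! ### Extensions as block substitutions -/

section FirstType

variable {n : ℕ} {j : Fin n} {N : ℕ}

theorem isBlockAt_id (hN : N ≠ 0) :
    IsBlockAt (id : Fin n → Fin n) (Function.update 1 j N) j where
  surj := Function.surjective_id
  ne_zero i := by
    by_cases hi : i = j
    · subst hi; simpa using hN
    · simp [hi]
  eq_one i hi := by simp [show i ≠ j from hi]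
  inj i i' _ h := h

theorem stretchSet_eq (T : Set (Fin n → ℕ)) :
    stretchSet j N T = blockSubst id (Function.update 1 j N) '' T := by
  unfold stretchSet
  congr 1
  ext u i
  by_cases hi : i = j
  · subst hi; simp
  · simp [hi]

theorem axisSet_Iio_eq (hN : N ≠ 0) :
    axisSet j (Set.Iio N) = blockCorner id (Function.update 1 j N) := by
  ext l
  constructor
  · rintro ⟨c, hc, rfl⟩
    exact (isBlockAt_id hN).mem_corner (fun i hi => by simp [show i ≠ j from hi])
      ⟨j, rfl, by simpa using hc⟩
  · intro hl
    refine ⟨l j, ?_, ?_⟩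
    · obtain ⟨i, rfl, hi⟩ := hl j
      simpa using hi
    · ext i
      by_cases hi : i = j
      · subst hi; simp
      · simp [hi, (isBlockAt_id hN).corner_eq_zero hl (i := i) hi]

theorem axisSet_isDirectSum {C D E : Set ℕ} (h : IsDirectSum C D E) :
    IsDirectSum (axisSet j C) (axisSet j D) (axisSet j E) :=
  h.image (AddMonoidHom.single (fun _ : Fin n => ℕ) j) (Pi.single_injective (M := fun _ : Fin n => ℕ) j)

end FirstType

section SecondType

variable {n n' m : ℕ} {j : Fin n} (e : {i : Fin n // i ≠ j} ⊕ Fin m ≃ Fin n') (a : Fin m → ℕ)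

/-- The old variable in which a new one is substituted. -/
def blockProj (k : Fin n') : Fin n := Sum.elim Subtype.val (fun _ => j) (e.symm k)

/-- The exponent with which a new variable is substituted. -/
def blockExp (k : Fin n') : ℕ := Sum.elim (fun _ => 1) a (e.symm k)

@[simp] theorem blockProj_inl (i) : blockProj e (e (Sum.inl i)) = i := by simp [blockProj]
@[simp] theorem blockProj_inr (r) : blockProj e (e (Sum.inr r)) = j := by simp [blockProj]
@[simp] theorem blockExp_inl (i) : blockExp e a (e (Sum.inl i)) = 1 := by simp [blockExp]
@[simp] theorem blockExp_inr (r) : blockExp e a (e (Sum.inr r)) = a r := by simp [blockExp]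

variable {a}

theorem isBlockAt_blockProj (hm : m ≠ 0) (ha : ∀ r, a r ≠ 0) :
    IsBlockAt (blockProj e) (blockExp e a) j where
  surj c := by
    by_cases hc : c = j
    · exact ⟨e (Sum.inr ⟨0, Nat.pos_of_ne_zero hm⟩), by simp [hc]⟩
    · exact ⟨e (Sum.inl ⟨c, hc⟩), by simp⟩
  ne_zero k := by
    obtain ⟨i | r, rfl⟩ := e.surjective k
    · simp
    · simpa using ha r
  eq_one k hk := by
    obtain ⟨i | r, rfl⟩ := e.surjective k
    · simp
    · simp at hk
  inj k k' hk h := by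
    obtain ⟨i | r, rfl⟩ := e.surjective k
    · obtain ⟨i' | r', rfl⟩ := e.surjective k'
      · simp only [blockProj_inl] at h
        rw [Subtype.ext h]
      · simp only [blockProj_inl, blockProj_inr] at h
        exact absurd h.symm i.2
    · simp at hk

theorem substSet_eq (T : Set (Fin n → ℕ)) :
    substSet e a T = blockSubst (blockProj e) (blockExp e a) '' T := by
  unfold substSet
  congr 1
  ext u k
  obtain ⟨i | r, rfl⟩ := e.surjective k
  · simp
  · simp [mul_comm]

theorem blockSet_singleton_zero : blockSet e {0} = {0} := by
  unfold blockSet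
  rw [Set.image_singleton]
  congr 1
  ext k
  obtain ⟨i | r, rfl⟩ := e.surjective k <;> simp

theorem mem_cornerSet_iff {l : Fin m → ℕ} : l ∈ cornerSet a ↔ ∃ r, l r < a r := by
  unfold cornerSet
  simp only [Set.mem_sdiff, Set.mem_univ, true_and, Set.mem_range]
  constructor
  · intro h
    by_contra! hn
    exact h ⟨l - a, by ext r; have := hn r; simp; omega⟩
  · rintro ⟨r, hr⟩ ⟨z, rfl⟩
    simp at hr

theorem blockSet_cornerSet_eq (hm : m ≠ 0) (ha : ∀ r, a r ≠ 0) :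
    blockSet e (cornerSet a) = blockCorner (blockProj e) (blockExp e a) := by
  have hb := isBlockAt_blockProj e hm ha
  ext l
  constructor
  · rintro ⟨z, hz, rfl⟩
    obtain ⟨r, hr⟩ := mem_cornerSet_iff.1 hz
    refine hb.mem_corner (fun k hk => ?_) ⟨e (Sum.inr r), by simp, by simpa using hr⟩
    obtain ⟨i | r, rfl⟩ := e.surjective k
    · simp
    · simp at hk
  · intro hl
    refine ⟨fun r => l (e (Sum.inr r)), mem_cornerSet_iff.2 ?_, ?_⟩
    · obtain ⟨k, hk, hlt⟩ := hl j
      obtain ⟨i | r, rfl⟩ := e.surjective k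
      · exact absurd (by simpa using hk) i.2
      · exact ⟨r, by simpa using hlt⟩
    · ext k
      obtain ⟨i | r, rfl⟩ := e.surjective k
      · have := hb.corner_eq_zero hl (i := e (Sum.inl i)) (by simpa using i.2)
        simp [this]
      · simp

end SecondType

/-- Both types of extension in terms of block substitutions. -/
structure IsBlockExtension (P Q : SetPair) (q : Fin Q.dim → Fin P.dim) (a : Fin Q.dim → ℕ)
    (j : Fin P.dim) (C D : Set (Fin Q.dim → ℕ)) : Prop where
  isBlockAt : IsBlockAt q a j
  corner : IsDirectSum C D (blockCorner q a)
  left : IsDirectSum C (blockSubst q a '' P.T) Q.T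
  right : IsDirectSum D (blockSubst q a '' P.S) Q.S

theorem FirstTypeExtension.exists_isBlockExtension {P Q : SetPair} (h : FirstTypeExtension P Q) :
    ∃ q a j C D, IsBlockExtension P Q q a j C D ∧ Function.Injective q := by
  obtain ⟨T, S, T', S', j, N, C, D, hN, hCD, hT, hS⟩ := h
  refine ⟨id, Function.update 1 j N, j, axisSet j C, axisSet j D,
    ⟨isBlockAt_id (by omega), ?_, ?_, ?_⟩, Function.injective_id⟩
  · rw [← axisSet_Iio_eq (by omega)]
    exact axisSet_isDirectSum hCD.1
  · simpa only [← stretchSet_eq] using hT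
  · simpa only [← stretchSet_eq] using hS

theorem SecondTypeExtension.exists_isBlockExtension {δ : Fin 2} {P Q : SetPair}
    (h : SecondTypeExtension δ P Q) :
    ∃ q a j C D, IsBlockExtension P Q q a j C D ∧ (δ = 0 ∧ C = {0} ∨ δ = 1 ∧ D = {0}) := by
  obtain ⟨T, S, T', S', j, e, a, hm, ha, hT, hS⟩ := h
  rw [substSet_eq] at hT hS
  have hb := isBlockAt_blockProj e (by omega) ha
  have hc := blockSet_cornerSet_eq e (by omega) ha
  refine ⟨blockProj e, blockExp e a, j, _, _, ⟨hb, ?_, hT, hS⟩, ?_⟩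
  · rw [← hc]
    fin_cases δ
    · simpa [setPow, blockSet_singleton_zero] using isDirectSum_singleton_zero _
    · simpa [setPow, blockSet_singleton_zero] using (isDirectSum_singleton_zero _).symm
  · fin_cases δ
    · left; simp [setPow, blockSet_singleton_zero]
    · right; simp [setPow, blockSet_singleton_zero]

theorem SecondTypeExtension.dim_lt {δ : Fin 2} {P Q : SetPair} (h : SecondTypeExtension δ P Q) :
    P.dim < Q.dim := by
  obtain ⟨T, S, T', S', j, e, a, hm, ha, hT, hS⟩ := h
  have := Fintype.card_congr e
  simp [Fintype.card_subtype_compl] at this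
  change _ < _
  have := j.pos
  simp only
  omega

/-! ### Extensions of primitive pairs -/

section Extension

variable {P Q : SetPair} {q : Fin Q.dim → Fin P.dim} {a : Fin Q.dim → ℕ} {j : Fin P.dim}
  {C D : Set (Fin Q.dim → ℕ)}

/-- Regroup `(C ⊕ D) ⊕ (s T ⊕ s S)`, the sum of the corner and the range of `s`, as `(C ⊕ s T) ⊕ (D
⊕ s S)`. -/
theorem IsBlockExtension.isNStarPair (h : IsBlockExtension P Q q a j C D) (hP : P.IsNStarPair) :
    Q.IsNStarPair := by
  have hb := h.isBlockAt
  refine ⟨?_, isComplementingPair_univ_iff.2 ?_⟩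
  · obtain ⟨i, -⟩ := hb.surj ⟨0, hP.1⟩
    exact i.pos
  · refine h.corner.add_add_comm (hP.isDirectSum.image _
      (blockSubst_injective hb.surj hb.ne_zero)) ?_ h.left h.right
    rw [Set.image_univ]
    exact blockCorner_isDirectSum hb.surj hb.ne_zero

theorem IsBlockExtension.zero_mem (h : IsBlockExtension P Q q a j C D) : 0 ∈ C ∧ 0 ∈ D :=
  h.corner.zero_mem (zero_mem_blockCorner h.isBlockAt.surj h.isBlockAt.ne_zero)

theorem IsBlockExtension.mem_left (h : IsBlockExtension P Q q a j C D) (u : Fin P.dim → ℕ) :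
    blockSubst q a u ∈ Q.T ↔ u ∈ P.T := by
  refine blockSubst_mem_iff h.isBlockAt.surj h.isBlockAt.ne_zero (fun c hc => ?_) h.zero_mem.1
    h.left u
  simpa using h.corner.add_mem hc h.zero_mem.2

theorem IsBlockExtension.mem_right (h : IsBlockExtension P Q q a j C D) (u : Fin P.dim → ℕ) :
    blockSubst q a u ∈ Q.S ↔ u ∈ P.S := by
  refine blockSubst_mem_iff h.isBlockAt.surj h.isBlockAt.ne_zero (fun c hc => ?_) h.zero_mem.2
    h.right u
  simpa using h.corner.add_mem h.zero_mem.1 hc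

/-- A splitting of an extension of a primitive pair has to separate the new variables. -/
theorem IsBlockExtension.exists_separated (h : IsBlockExtension P Q q a j C D)
    (hP : P.IsPrimitive) {K : Set (Fin Q.dim)} (hK : K.Nonempty) (hK' : K ≠ Set.univ)
    (hs : ∀ x, SplitsAt K Q.T x ∧ SplitsAt K Q.S x) :
    ∃ i ∈ K, ∃ i' ∉ K, q i = j ∧ q i' = j ∧ i ≠ i' := by
  by_contra! hn
  -- No fibre meets both `K` and its complement, so `K` is a union of fibres and the splitting
  -- descends to `P`.
  have hsat : K = q ⁻¹' (q '' K) := by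
    refine (Set.subset_preimage_image q K).antisymm ?_
    rintro i' ⟨i, hi, e⟩
    by_contra hi'
    by_cases hj : q i = j
    · exact hi' (hn i hi i' hi' hj (e ▸ hj) ▸ hi)
    · exact hi' (h.isBlockAt.inj i i' hj e.symm ▸ hi)
  obtain ⟨u, hu⟩ := (SetPair.isPrimitive_iff.1 hP).2 (q '' K) (hK.image q) (fun hu => hK' (by
    rw [hsat, hu, Set.preimage_univ]))
  rw [hsat] at hs
  exact hu ⟨splitsAt_of_preimage h.mem_left (hs _).1, splitsAt_of_preimage h.mem_right (hs _).2⟩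

theorem IsBlockExtension.isPrimitive_of_injective (h : IsBlockExtension P Q q a j C D)
    (hP : P.IsPrimitive) (hq : Function.Injective q) : Q.IsPrimitive := by
  refine SetPair.isPrimitive_iff.2 ⟨h.isNStarPair hP.1, fun K hK hK' => ?_⟩
  by_contra! hn
  obtain ⟨i, -, i', -, hi, hi', hne⟩ := h.exists_separated hP hK hK' fun x => not_not.1 (hn x)
  exact hne (hq (hi.trans hi'.symm))

end Extension

/-- A substituted vector vanishes at all coordinates of a fibre or at none, while restriction to `K`
kills the coordinate `i'` and keeps `i`. -/
theorem apply_eq_zero_of_separated {ι κ : Type*} {q : ι → κ} {a : ι → ℕ} (ha : ∀ i, a i ≠ 0)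
    {X : Set (κ → ℕ)} {K : Set ι} (hs : ∀ x, SplitsAt K (blockSubst q a '' X) x) {i i' : ι}
    (hi : i ∈ K) (hi' : i' ∉ K) (h : q i = q i') {u : κ → ℕ} (hu : u ∈ X) : u (q i) = 0 := by
  obtain ⟨v, -, hv⟩ := ((hs _).1 ⟨u, hu, rfl⟩).1
  have h1 := congrFun hv i
  have h2 := congrFun hv i'
  rw [Set.indicator_of_mem hi] at h1
  rw [Set.indicator_of_notMem hi'] at h2
  simp only [blockSubst_apply, mul_eq_zero, ha, false_or] at h2
  simp only [blockSubst_apply, h, h2, mul_zero] at h1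
  rw [h]
  simpa [ha] using h1.symm

theorem eq_univ_of_forall_apply_eq_zero {n : ℕ} {X Z : Set (Fin n → ℕ)}
    (h : IsDirectSum X Z Set.univ) {j : Fin n} (hX : ∀ x ∈ X, x j = 0) (hj : {j} = Set.univ) :
    n = 1 ∧ X = {0} ∧ Z = Set.univ := by
  have hall : ∀ i, i = j := fun i => by
    have : i ∈ ({j} : Set (Fin n)) := hj ▸ Set.mem_univ i
    exact this
  have hX' : X = {0} := by
    refine Set.eq_singleton_iff_unique_mem.2 ⟨h.zero_mem_left, fun x hx => ?_⟩
    ext i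
    rw [hall i]
    exact hX x hx
  refine ⟨?_, hX', (hX' ▸ h).eq_right⟩
  have : Subsingleton (Fin n) := ⟨fun i i' => (hall i).trans (hall i').symm⟩
  have := Fintype.card_le_one_iff_subsingleton.2 this
  have := j.pos
  simp at *
  omega

/-- A splitting would separate the block, so the set that receives no corner comes from one avoiding
`x_j`. The base then splits along `{j}`, unless `j` is its only coordinate, which is the illegal
case. -/
theorem SetPair.isPrimitive_of_legal_extension {P Q : SetPair} (hP : P.IsPrimitive)
    (h : IsExtension P Q) (hl : ¬ IsIllegalExtension P Q) : Q.IsPrimitive := by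
  rcases h with h | ⟨δ, h⟩
  · obtain ⟨q, a, j, C, D, hb, hq⟩ := h.exists_isBlockExtension
    exact hb.isPrimitive_of_injective hP hq
  obtain ⟨q, a, j, C, D, hb, hδ⟩ := h.exists_isBlockExtension
  refine SetPair.isPrimitive_iff.2 ⟨hb.isNStarPair hP.1, fun K hK hK' => ?_⟩
  by_contra! hn
  have hs : ∀ x, SplitsAt K Q.T x ∧ SplitsAt K Q.S x := fun x => not_not.1 (hn x)
  obtain ⟨i, hi, i', hi', hij, hij', -⟩ := hb.exists_separated hP hK hK' hs
  have hPd := hP.1.isDirectSum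
  rcases hδ with ⟨rfl, rfl⟩ | ⟨rfl, rfl⟩
  · have hQ := hb.left.eq_right
    have h0 : ∀ u ∈ P.T, u j = 0 := fun u hu => hij ▸ apply_eq_zero_of_separated
      hb.isBlockAt.ne_zero (fun x => hQ ▸ (hs x).1) hi hi' (hij.trans hij'.symm) hu
    by_cases hj : {j} = Set.univ
    · obtain ⟨h1, h2, h3⟩ := eq_univ_of_forall_apply_eq_zero hPd h0 hj
      refine hl (Or.inl ⟨?_, h⟩)
      clear * - h1 h2 h3
      obtain ⟨n, T, S⟩ := P
      obtain rfl : n = 1 := h1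
      exact congrArg₂ (SetPair.mk 1) h2 h3
    · obtain ⟨u, hu⟩ := (SetPair.isPrimitive_iff.1 hP).2 {j} (Set.singleton_nonempty j) hj
      exact hu (splitsAt_singleton hPd h0 u)
  · have hQ := hb.right.eq_right
    have h0 : ∀ u ∈ P.S, u j = 0 := fun u hu => hij ▸ apply_eq_zero_of_separated
      hb.isBlockAt.ne_zero (fun x => hQ ▸ (hs x).2) hi hi' (hij.trans hij'.symm) hu
    by_cases hj : {j} = Set.univ
    · obtain ⟨h1, h2, h3⟩ := eq_univ_of_forall_apply_eq_zero hPd.symm h0 hj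
      refine hl (Or.inr ⟨?_, h⟩)
      clear * - h1 h2 h3
      obtain ⟨n, T, S⟩ := P
      obtain rfl : n = 1 := h1
      exact congrArg₂ (SetPair.mk 1) h3 h2
    · obtain ⟨u, hu⟩ := (SetPair.isPrimitive_iff.1 hP).2 {j} (Set.singleton_nonempty j) hj
      exact hu (splitsAt_singleton hPd.symm h0 u).symm

theorem SetPair.IsNStarPair.isPrimitive_of_dim_eq_one {P : SetPair} (hP : P.IsNStarPair)
    (h : P.dim = 1) : P.IsPrimitive := by
  refine ⟨hP, ?_⟩
  rintro ⟨P₁, P₂, h₁, -, hlt, -⟩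
  have := h₁.1
  omega

/-! ### Reducing a primitive pair -/

/-- The pair with the two sets exchanged. -/
def SetPair.swap (P : SetPair) : SetPair := ⟨P.dim, P.S, P.T⟩

theorem SetPair.IsPrimitive.swap {P : SetPair} (h : P.IsPrimitive) : P.swap.IsPrimitive := by
  obtain ⟨h1, h2⟩ := SetPair.isPrimitive_iff.1 h
  refine SetPair.isPrimitive_iff.2 ⟨⟨h1.1, isComplementingPair_univ_iff.2 h1.isDirectSum.symm⟩,
    fun K hK hK' => ?_⟩
  obtain ⟨x, hx⟩ := h2 K hK hK'
  exact ⟨x, fun hs => hx hs.symm⟩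

theorem FirstTypeExtension.swap {P Q : SetPair} (h : FirstTypeExtension P Q) :
    FirstTypeExtension P.swap Q.swap := by
  obtain ⟨T, S, T', S', j, N, C, D, hN, hCD, hT, hS⟩ := h
  exact ⟨S, T, S', T', j, N, D, C, hN, ⟨hCD.1.symm, hCD.2.2, hCD.2.1⟩, hS, hT⟩

theorem SecondTypeExtension.swap {δ : Fin 2} {P Q : SetPair} (h : SecondTypeExtension δ P Q) :
    SecondTypeExtension (1 - δ) P.swap Q.swap := by
  obtain ⟨T, S, T', S', j, e, a, hm, ha, hT, hS⟩ := h
  exact ⟨S, T, S', T', j, e, a, hm, ha, hS, by rwa [sub_sub_cancel]⟩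

theorem IsCornerExtension.obstructs {P Q : SetPair} {q : Fin Q.dim → Fin P.dim}
    {a : Fin Q.dim → ℕ} (h : IsCornerExtension q a P.T P.S Q.T Q.S) {K : Set (Fin P.dim)}
    {l : Fin Q.dim → ℕ} (hl : l ∈ blockCorner q a) {u : Fin P.dim → ℕ}
    (hx : Q.Obstructs (q ⁻¹' K) (l + blockSubst q a u)) : P.Obstructs K u :=
  fun hs => hx (h.splitsAt hl hs.1 hs.2)

/-- An obstruction `l + s u` for the preimage of `K` under `q` gives the obstruction `u` for `K`. -/
theorem IsCornerExtension.isPrimitive {P Q : SetPair} {q : Fin Q.dim → Fin P.dim}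
    {a : Fin Q.dim → ℕ} (h : IsCornerExtension q a P.T P.S Q.T Q.S) (hd : 1 ≤ P.dim)
    (hQ : Q.IsPrimitive) : P.IsPrimitive := by
  refine SetPair.isPrimitive_iff.2 ⟨⟨hd, isComplementingPair_univ_iff.2
    (h.isDirectSum_base hQ.1.isDirectSum)⟩, fun K hK hK' => ?_⟩
  obtain ⟨x, hx⟩ := (SetPair.isPrimitive_iff.1 hQ).2 (q ⁻¹' K) (hK.preimage h.surj) (fun hu =>
    hK' (by rw [← Set.image_preimage_eq K h.surj, hu, Set.image_univ, h.surj.range_eq]))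
  obtain ⟨l, hl, u, rfl⟩ := exists_blockCorner_add h.surj h.ne_zero x
  exact ⟨u, h.obstructs hl hx⟩

/-- `P` is a reduction of `Q`: either of smaller dimension, or of the same dimension with smaller
witnesses for primitivity. -/
def IsReduction (P Q : SetPair) : Prop :=
  P.IsPrimitive ∧ ((∃ δ, SecondTypeExtension δ P Q) ∨
    (FirstTypeExtension P Q ∧ ∃ h : Q.dim = P.dim, ∃ j : Fin Q.dim,
      ∀ (i : Fin Q.dim) (x : Fin Q.dim → ℕ), Q.Obstructs {i} x →
        ∃ u : Fin Q.dim → ℕ, P.Obstructs {Fin.cast h i} (fun k => u (Fin.cast h.symm k)) ∧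
          u ≤ x ∧ (x j ≠ 0 → u j < x j)))

theorem IsReduction.swap {P Q : SetPair} (h : IsReduction P Q) : IsReduction P.swap Q.swap := by
  refine ⟨h.1.swap, h.2.imp ?_ ?_⟩
  · rintro ⟨δ, h⟩
    exact ⟨_, h.swap⟩
  · rintro ⟨h1, hd, j, h2⟩
    refine ⟨h1.swap, hd, j, fun i x hx => ?_⟩
    obtain ⟨u, hu, h3⟩ := h2 i x fun hs => hx hs.symm
    exact ⟨u, fun hs => hu hs.symm, h3⟩

theorem exists_isReduction_of_face {Q : SetPair} (hQ : Q.IsPrimitive) {b : Fin Q.dim → ℕ}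
    (hb : b ∈ Q.S) (hb0 : b ≠ 0) (hbA : ∀ i, b i ≠ 0 → Pi.single i 1 ∈ Q.T) :
    ∃ P, IsReduction P Q := by
  classical
  have hd := hQ.1.isDirectSum
  obtain ⟨v, hvB, hv0, hvA, hcorner⟩ := hd.exists_generator hb hb0 hbA
  obtain ⟨j, hj⟩ : ∃ j, v j ≠ 0 := by
    by_contra! hn
    exact hv0 (funext hn)
  by_cases hsingle : ∀ i, v i ≠ 0 → i = j
  · -- the generator lies on an axis
    have hv : v = Pi.single j (v j) := by
      ext i
      by_cases hi : i = j
      · subst hi; simp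
      · by_contra hn
        refine hi (hsingle i fun h0 => hn ?_)
        simp [hi, h0]
    -- If `v j = 1`, the unit vector at `j` would lie in both sets.
    have hN : 2 ≤ v j := by
      by_contra! hlt
      have h1 : v j = 1 := by omega
      have := hvA j hj
      rw [hv, h1] at hvB
      have := congrFun (hd.eq_zero_of_mem this hvB) j
      simp at this
    have hblock := isBlockAt_id (j := j) hj
    have hext := hblock.isCornerExtension hd (fun l hl => by
      refine hcorner l (fun i hi => ?_) fun hle => ?_
      · exact hblock.corner_eq_zero hl (i := i) (by rintro rfl; exact hj hi)
      · obtain ⟨i, hi, hlt⟩ := hl j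
        obtain rfl : i = j := hi
        rw [Function.update_self] at hlt
        exact absurd (hle i) (not_le.2 hlt)) (by
      convert hvB
      ext i
      by_cases hi : i = j
      · subst hi; simp
      · rw [hv]; simp [hi])
    set s := blockSubst id (Function.update 1 j (v j)) with hs
    refine ⟨⟨Q.dim, {u | s u ∈ Q.T}, {u | s u ∈ Q.S}⟩, hext.isPrimitive hQ.1.1 hQ, Or.inr
      ⟨⟨_, _, _, _, j, v j, Set.Iio (v j), {0}, hN, ⟨(isDirectSum_singleton_zero _).symm,
        subset_rfl, by simpa using by omega⟩, ?_, ?_⟩, rfl, j, fun i x hx => ?_⟩⟩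
    · rw [axisSet_Iio_eq hj, stretchSet_eq]
      exact hext.isDirectSum_left
    · rw [stretchSet_eq]
      have : axisSet j {0} = {0} := by simp [axisSet]
      rw [this]
      exact hext.isDirectSum_right
    · obtain ⟨l, hl, u, rfl⟩ := exists_blockCorner_add hblock.surj hblock.ne_zero x
      refine ⟨u, hext.obstructs (P := ⟨Q.dim, {u | s u ∈ Q.T}, {u | s u ∈ Q.S}⟩)
        (K := {i}) hl hx, fun k => ?_, fun hne => ?_⟩
      · have := Nat.pos_of_ne_zero (hblock.ne_zero k)
        simp only [Pi.add_apply, blockSubst_apply, id]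
        nlinarith
      · simp only [Pi.add_apply, blockSubst_apply, id, Function.update_self] at hne ⊢
        rcases Nat.eq_zero_or_pos (u j) with h0 | h0
        · omega
        · nlinarith
  · -- the generator has at least two nonzero coordinates
    push Not at hsingle
    obtain ⟨j', hj', hjj'⟩ := hsingle
    let Y : Set (Fin Q.dim) := {i | v i ≠ 0}
    -- The support `Y` of `v` collapses to the variable `0` of the base; the remaining coordinates
    -- become the nonzero indices.
    let e : {i : Fin (Fintype.card (Yᶜ : Set _) + 1) // i ≠ 0} ⊕ Fin (Fintype.card Y) ≃
        Fin Q.dim :=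
      ((Equiv.sumCongr ((finSuccAboveEquiv 0).symm.trans (Fintype.equivFin (Yᶜ : Set _)).symm)
        (Fintype.equivFin Y).symm).trans (Equiv.sumComm _ _)).trans (Equiv.Set.sumCompl Y)
    have hel : ∀ i, v (e (Sum.inl i)) = 0 := fun i => by
      have : e (Sum.inl i) ∈ Yᶜ := by
        simp only [e, Equiv.trans_apply, Equiv.sumCongr_apply, Sum.map_inl, Equiv.sumComm_apply,
          Sum.swap_inl, Equiv.Set.sumCompl_apply_inr]
        exact Subtype.coe_prop _
      exact not_not.1 this
    have her : ∀ r, v (e (Sum.inr r)) ≠ 0 := fun r => by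
      have : e (Sum.inr r) ∈ Y := by
        simp only [e, Equiv.trans_apply, Equiv.sumCongr_apply, Sum.map_inr, Equiv.sumComm_apply,
          Sum.swap_inr, Equiv.Set.sumCompl_apply_inl]
        exact Subtype.coe_prop _
      exact this
    let a : Fin (Fintype.card Y) → ℕ := fun r => v (e (Sum.inr r))
    have hm : 2 ≤ Fintype.card Y := Fintype.one_lt_card_iff.2
      ⟨⟨j, hj⟩, ⟨j', hj'⟩, fun h => hjj' (congrArg Subtype.val h).symm⟩
    have ha : ∀ r, a r ≠ 0 := her
    have hblock := isBlockAt_blockProj e (by omega) ha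
    have hext := hblock.isCornerExtension hd (fun l hl => by
      refine hcorner l (fun k hk => ?_) fun hle => ?_
      · obtain ⟨i | r, rfl⟩ := e.surjective k
        · exact hblock.corner_eq_zero hl (by simpa using i.2)
        · exact absurd hk (her r)
      · obtain ⟨k, hk, hlt⟩ := hl 0
        obtain ⟨i | r, rfl⟩ := e.surjective k
        · exact absurd (by simpa using hk) i.2
        · rw [blockExp_inr] at hlt
          exact absurd (hle (e (Sum.inr r))) (not_le.2 hlt)) (by
      convert hvB
      ext k
      obtain ⟨i | r, rfl⟩ := e.surjective k
      · simp [hel i, i.2]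
      · simp [a])
    set s := blockSubst (blockProj e) (blockExp e a) with hs
    refine ⟨⟨_, {u | s u ∈ Q.T}, {u | s u ∈ Q.S}⟩,
      hext.isPrimitive (P := ⟨_, {u | s u ∈ Q.T}, {u | s u ∈ Q.S}⟩) (Nat.le_add_left _ _) hQ,
      Or.inl ⟨1, ⟨{u | s u ∈ Q.T}, {u | s u ∈ Q.S}, _, _, 0, e, a, hm, ha, ?_, ?_⟩⟩⟩
    · rw [substSet_eq, setPow, if_neg (by decide), blockSet_cornerSet_eq e (by omega) ha]
      exact hext.isDirectSum_left
    · rw [substSet_eq, setPow, if_pos (by decide), blockSet_singleton_zero]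
      exact hext.isDirectSum_right

/-- If neither set supplies a generator, both are faces and split along everything, which
primitivity forbids in dimension at least 2. -/
theorem exists_isReduction {Q : SetPair} (hQ : Q.IsPrimitive) (hdim : 2 ≤ Q.dim) :
    ∃ P, IsReduction P Q := by
  by_cases h1 : ∃ b ∈ Q.S, b ≠ 0 ∧ ∀ i, b i ≠ 0 → Pi.single i 1 ∈ Q.T
  · obtain ⟨b, hb, hb0, hbA⟩ := h1
    exact exists_isReduction_of_face hQ hb hb0 hbA
  by_cases h2 : ∃ b ∈ Q.T, b ≠ 0 ∧ ∀ i, b i ≠ 0 → Pi.single i 1 ∈ Q.S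
  · obtain ⟨b, hb, hb0, hbA⟩ := h2
    obtain ⟨P, hP⟩ := exists_isReduction_of_face hQ.swap hb hb0 hbA
    exact ⟨P.swap, hP.swap⟩
  exfalso
  have h1' : ∀ b ∈ Q.S, (∀ i, b i ≠ 0 → Pi.single i 1 ∈ Q.T) → b = 0 := fun b hb hi => by
    by_contra hb0; exact h1 ⟨b, hb, hb0, hi⟩
  have h2' : ∀ b ∈ Q.T, (∀ i, b i ≠ 0 → Pi.single i 1 ∈ Q.S) → b = 0 := fun b hb hi => by
    by_contra hb0; exact h2 ⟨b, hb, hb0, hi⟩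
  have hd := hQ.1.isDirectSum
  obtain ⟨x, hx⟩ := (SetPair.isPrimitive_iff.1 hQ).2 {⟨0, by omega⟩} (Set.singleton_nonempty _)
    (fun hu => by
      have : (⟨1, by omega⟩ : Fin Q.dim) ∈ ({⟨0, by omega⟩} : Set (Fin Q.dim)) :=
        hu ▸ Set.mem_univ _
      simp at this)
  exact hx ⟨splitsAt_of_face (hd.mem_iff_of_faces h1' h2') _ x,
    splitsAt_of_face (hd.symm.mem_iff_of_faces h2' h1') _ x⟩

/-! ### Legality and termination of the descent -/

theorem splitsAt_singleton_zero {ι : Type*} (K : Set ι) (x : ι → ℕ) :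
    SplitsAt K {(0 : ι → ℕ)} x :=
  splitsAt_of_face (J := fun _ => False) (fun x => by
    simp only [Set.mem_singleton_iff, funext_iff, imp_false, not_not, Pi.zero_apply]) K x

theorem splitsAt_univ {ι : Type*} (K : Set ι) (x : ι → ℕ) : SplitsAt K Set.univ x := by
  simp [SplitsAt]

/-- An illegal extension has one set `{0}` and the other everything, in dimension at least 2, so it
splits. Hence every step of the descent is legal. -/
theorem not_isIllegalExtension {P Q : SetPair} (hQ : Q.IsPrimitive) : ¬ IsIllegalExtension P Q := by
  intro h
  have main : (∃ δ, SecondTypeExtension δ P Q) ∧ 1 ≤ P.dim ∧ (Q.T = {0} ∨ Q.S = {0}) := by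
    rcases h with ⟨rfl, h⟩ | ⟨rfl, h⟩
    · refine ⟨⟨_, h⟩, le_rfl, ?_⟩
      obtain ⟨q, a, j, C, D, hb, ⟨-, rfl⟩ | ⟨h, -⟩⟩ := h.exists_isBlockExtension
      · left
        rw [← hb.left.eq_right]
        simp
      · exact absurd h (by decide)
    · refine ⟨⟨_, h⟩, le_rfl, ?_⟩
      obtain ⟨q, a, j, C, D, hb, ⟨h, -⟩ | ⟨-, rfl⟩⟩ := h.exists_isBlockExtension
      · exact absurd h (by decide)
      · right
        rw [← hb.right.eq_right]
        simp
  obtain ⟨⟨δ, hδ⟩, hP, h0⟩ := main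
  have hlt := hδ.dim_lt
  have hd := hQ.1.isDirectSum
  obtain ⟨x, hx⟩ := (SetPair.isPrimitive_iff.1 hQ).2 {⟨0, by omega⟩} (Set.singleton_nonempty _)
    (fun hu => by
      have : (⟨1, by omega⟩ : Fin Q.dim) ∈ ({⟨0, by omega⟩} : Set (Fin Q.dim)) :=
        hu ▸ Set.mem_univ _
      simp at this)
  refine hx ?_
  rcases h0 with h0 | h0
  · have h1 : Q.S = Set.univ := (h0 ▸ hd).eq_right
    rw [h0, h1]
    exact ⟨splitsAt_singleton_zero _ x, splitsAt_univ _ x⟩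
  · have h1 : Q.T = Set.univ := (h0 ▸ hd.symm).eq_right
    rw [h0, h1]
    exact ⟨splitsAt_univ _ x, splitsAt_singleton_zero _ x⟩

/-- Ensures that a first type reduction at `j` strictly shrinks the witness for `{j}`. -/
theorem SetPair.Obstructs.apply_ne_zero {Q : SetPair} (hQ : Q.IsNStarPair) {i : Fin Q.dim}
    {x : Fin Q.dim → ℕ} (h : Q.Obstructs {i} x) : x i ≠ 0 := by
  intro h0
  have h1 : ({i} : Set (Fin Q.dim)).indicator x = 0 := by
    ext k
    by_cases hk : k = i
    · subst hk; simp [h0]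
    · simp [hk]
  have h2 : ({i}ᶜ : Set (Fin Q.dim)).indicator x = x := by
    have := Set.indicator_self_add_compl {i} x
    rwa [h1, zero_add] at this
  refine h ⟨?_, ?_⟩ <;> unfold SplitsAt <;> rw [h1, h2]
  · simp [hQ.isDirectSum.zero_mem_left]
  · simp [hQ.isDirectSum.zero_mem_right]

/-- Induction on the dimension and, within a dimension, on the total size of one chosen obstruction
per singleton. -/
theorem SetPair.IsPrimitive.exists_base {Q : SetPair} (hQ : Q.IsPrimitive) :
    ∃ P₀ : SetPair, P₀.IsNStarPair ∧ P₀.dim = 1 ∧ IsLegalFiniteExtension P₀ Q := by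
  induction hn : Q.dim using Nat.strong_induction_on generalizing Q with
  | _ n IHn =>
  by_cases hdim : 2 ≤ Q.dim
  swap
  · exact ⟨Q, hQ.1, by have := hQ.1.1; omega, Relation.ReflTransGen.refl⟩
  have hw : ∀ i : Fin Q.dim, ∃ x, Q.Obstructs {i} x := fun i =>
    (SetPair.isPrimitive_iff.1 hQ).2 {i} (Set.singleton_nonempty i) (fun hu => by
      have h0 : (⟨0, by omega⟩ : Fin Q.dim) ∈ ({i} : Set (Fin Q.dim)) := hu ▸ Set.mem_univ _
      have h1 : (⟨1, by omega⟩ : Fin Q.dim) ∈ ({i} : Set (Fin Q.dim)) := hu ▸ Set.mem_univ _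
      have := h0.trans h1.symm
      simp at this)
  choose w hw using hw
  induction hM : ∑ i, ∑ k, w i k using Nat.strong_induction_on generalizing Q with
  | _ M IHM =>
  have hstep : ∀ {P}, IsExtension P Q → (∃ P₀ : SetPair, P₀.IsNStarPair ∧ P₀.dim = 1 ∧
      IsLegalFiniteExtension P₀ P) → ∃ P₀ : SetPair, P₀.IsNStarPair ∧ P₀.dim = 1 ∧
      IsLegalFiniteExtension P₀ Q := by
    rintro P hPQ ⟨P₀, h0, h1, h2⟩
    exact ⟨P₀, h0, h1, h2.tail ⟨hPQ, not_isIllegalExtension hQ⟩⟩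
  obtain ⟨P, hP, ⟨δ, h⟩ | ⟨h, hd, j, hwit⟩⟩ := exists_isReduction hQ hdim
  · exact hstep (Or.inr ⟨δ, h⟩) (IHn P.dim (hn ▸ h.dim_lt) hP rfl)
  · refine hstep (Or.inl h) ?_
    obtain ⟨nP, T, S⟩ := P
    obtain rfl : Q.dim = nP := hd
    choose w' hw' hle hlt using fun i => hwit i (w i) (hw i)
    refine IHM _ ?_ hP hn hdim w' hw' rfl
    rw [← hM]
    refine Finset.sum_lt_sum (fun i _ => Finset.sum_le_sum fun k _ => hle i k)
      ⟨j, Finset.mem_univ j, Finset.sum_lt_sum (fun k _ => hle j k) ⟨j, Finset.mem_univ j, ?_⟩⟩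
    exact hlt j ((hw j).apply_ne_zero hQ.1)

theorem mainTheorem1 (P : SetPair) (hP : P.IsNStarPair) :
    P.IsPrimitive ↔
      ∃ P₀ : SetPair, P₀.IsNStarPair ∧ P₀.dim = 1 ∧ IsLegalFiniteExtension P₀ P := by
  refine ⟨fun h => h.exists_base, ?_⟩
  rintro ⟨P₀, h0, h1, h2⟩
  clear hP
  induction h2 with
  | refl => exact h0.isPrimitive_of_dim_eq_one h1
  | tail _ h IH => exact SetPair.isPrimitive_of_legal_extension IH h.1 h.2
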